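/- Let $\Omega\subset\mathbb{R}^2$ be a bounded simply connected Lipschitz domain, and let $\mathcal{G}_h$ be a finite conforming subdivision of $\overline\Omega$ into nondegenerate closed convex quadrilaterals (two different cells are disjoint, or meet exactly in a common vertex, or exactly in a common edge). Let $P_k(Q)$ denote the polynomials of total degree at most $k$ on a cell $Q$. A vertex is a boundary vertex if it lies on $\partial\Omega$; an edge is a boundary edge if it is contained in $\partial\Omega$, and an interior edge otherwise. For each edge $e$ fix a unit normal $\mathbf n_e$, and write $\fint_e$ for the mean value over $e$. For a piecewise polynomial function, "continuous" below means that the values computed from all cells that contain the vertex or edge in question agree, and "vanishes" means that the value computed from every such cell is zero. Define - $V^{\rm RQM}_{h0}$: all $v\in L^2(\Omega)$ with $v|_Q\in P_2(Q)$ for every $Q\in\mathcal{G}_h$, such that $v(a)$ is continuous at every vertex $a$ and vanishes at every boundary vertex, and $\int_e\partial_{\mathbf n_e}v\,\mathrm ds$ is continuous across every interior edge $e$ and vanishes on every boundary edge $e$; - $V^{\rm PS}_{h0}$: all $w\in L^2(\Omega)$ with $w|_Q\in P_1(Q)$ for every $Q\in\mathcal{G}_h$, such that $\fint_e w\,\mathrm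 ds$ is continuous across every interior edge $e$ and vanishes on every boundary edge $e$; - $\mathring{V}^{\rm PS}_{h0}$: all $w=(w_1,w_2)\in (V^{\rm PS}_{h0})^2$ with $\partial_1w_1+\partial_2w_2=0$ on every cell $Q\in\mathcal{G}_h$. Let $\mathrm{curl}_h v=(\partial_2v,-\partial_1v)$, computed cell by cell. Then $$\mathrm{curl}_h V^{\rm RQM}_{h0}=\mathring{V}^{\rm PS}_{h0}.$$ -/

import Mathlib

open MeasureTheory Set

noncomputable section

/-- The Euclidean plane. -/
abbrev Plane : Type := EuclideanSpace ℝ (Fin 2)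

/-- The space `L²(Ω)`. -/
abbrev L2 (Ω : Set Plane) : Type := Lp ℝ 2 (volume.restrict Ω)

/-- The planar cross product. -/
def cross (u v : Plane) : ℝ := u 0 * v 1 - u 1 * v 0

/-- Bounded Lipschitz domain: a bounded, connected open set which, near each boundary point and in
suitable orthonormal coordinates, is the part of the plane above the graph of a Lipschitz
function. -/
structure IsLipschitzDomain (Ω : Set Plane) : Prop where
  isOpen : IsOpen Ω
  isConnected : IsConnected Ω
  isBounded : Bornology.IsBounded Ω
  boundary : ∀ x ∈ frontier Ω, ∃ (T : Plane ≃ₗᵢ[ℝ] Plane) (K : NNReal) (f : ℝ → ℝ) (U : Set Plane),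
    LipschitzWith K f ∧ IsOpen U ∧ x ∈ U ∧ Ω ∩ U = {y | f (T y 0) < T y 1} ∩ U

/-- A nondegenerate convex quadrilateral, given by its vertices in counterclockwise order
(indices are cyclic): at every vertex the boundary turns strictly to the left. -/
structure ConvexQuad where
  vertex : Fin 4 → Plane
  ccw : ∀ k, 0 < cross (vertex (k + 1) - vertex k) (vertex (k + 2) - vertex (k + 1))

namespace ConvexQuad

/-- The closed region occupied by the quadrilateral. -/
def carrier (Q : ConvexQuad) : Set Plane := convexHull ℝ (range Q.vertex)

/-- `a` is a vertex of `Q`. -/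
def IsVertex (Q : ConvexQuad) (a : Plane) : Prop := ∃ k, Q.vertex k = a

/-- The segment with end points `a`, `b` (in either order) is an edge of `Q`. -/
def IsEdge (Q : ConvexQuad) (a b : Plane) : Prop :=
  ∃ k, (Q.vertex k = a ∧ Q.vertex (k + 1) = b) ∨ (Q.vertex k = b ∧ Q.vertex (k + 1) = a)

end ConvexQuad

/-- A subdivision of `Ω` into convex quadrilaterals: the closed cells cover the closure of `Ω`, and
two different cells are disjoint, or meet exactly in a common vertex, or exactly in a common
edge. -/
structure QuadMesh (Ω : Set Plane) (ι : Type*) where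
  cell : ι → ConvexQuad
  cover : ⋃ i, (cell i).carrier = closure Ω
  conforming : ∀ i j, i ≠ j →
    (cell i).carrier ∩ (cell j).carrier = ∅ ∨
    (∃ a, (cell i).IsVertex a ∧ (cell j).IsVertex a ∧
      (cell i).carrier ∩ (cell j).carrier = {a}) ∨
    (∃ a b, (cell i).IsEdge a b ∧ (cell j).IsEdge a b ∧
      (cell i).carrier ∩ (cell j).carrier = segment ℝ a b)

/-- Real polynomials in the two coordinates of the plane. -/
abbrev Poly2 : Type := MvPolynomial (Fin 2) ℝ

namespace Poly2

/-- The value of a polynomial at a point of the plane. -/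
def evalAt (p : Poly2) (x : Plane) : ℝ := MvPolynomial.eval (fun c => x c) p

/-- `curl p = (∂₂ p, -∂₁ p)`. -/
def curl (p : Poly2) : Fin 2 → Poly2 := ![MvPolynomial.pderiv 1 p, -MvPolynomial.pderiv 0 p]

/-- `div (p₁, p₂) = ∂₁ p₁ + ∂₂ p₂`. -/
def div (p : Fin 2 → Poly2) : Poly2 := MvPolynomial.pderiv 0 (p 0) + MvPolynomial.pderiv 1 (p 1)

/-- The derivative of `p` at `x` in the direction `n`. -/
def dirDeriv (p : Poly2) (n x : Plane) : ℝ :=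
  evalAt (MvPolynomial.pderiv 0 p) x * n 0 + evalAt (MvPolynomial.pderiv 1 p) x * n 1

end Poly2

/-- The mean value of a function over the segment from `a` to `b`. -/
def edgeMean (f : Plane → ℝ) (a b : Plane) : ℝ := ∫ t in (0 : ℝ)..1, f (AffineMap.lineMap a b t)

/-- The integral of a function over the segment from `a` to `b` with respect to arc length. -/
def edgeIntegral (f : Plane → ℝ) (a b : Plane) : ℝ := dist a b * edgeMean f a b

/-- The unit normal `n` to the segment from `a` to `b` for which `n × (b - a) > 0`. -/
def edgeNormal (a b : Plane) : Plane := (dist a b)⁻¹ • !₂[b 1 - a 1, -(b 0 - a 0)]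

namespace QuadMesh

variable {Ω : Set Plane} {ι : Type*}

/-- `a`, `b` are the end points of an edge of the mesh that lies on the boundary of `Ω`. -/
def IsBoundaryEdge (G : QuadMesh Ω ι) (a b : Plane) : Prop :=
  (∃ i, (G.cell i).IsEdge a b) ∧ segment ℝ a b ⊆ frontier Ω

/-- `a`, `b` are the end points of an edge of the mesh that does not lie on the boundary. -/
def IsInteriorEdge (G : QuadMesh Ω ι) (a b : Plane) : Prop :=
  (∃ i, (G.cell i).IsEdge a b) ∧ ¬ segment ℝ a b ⊆ frontier Ω

/-- On each cell the function `v` is given by the polynomial belonging to that cell. Since cells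
have interior points, the polynomials are determined by `v`; point values and edge integrals of `v`
taken from inside a cell are those of the polynomial. -/
def IsPiecewise (G : QuadMesh Ω ι) (v : L2 Ω) (p : ι → Poly2) : Prop :=
  ∀ i, ∀ᵐ x ∂(volume.restrict Ω), x ∈ (G.cell i).carrier → v x = (p i).evalAt x

/-- The reduced quadrilateral Morley space: piecewise quadratics, continuous at the vertices, with
the integral of the normal derivative continuous across interior edges. -/
def RQM (G : QuadMesh Ω ι) : Set (L2 Ω) :=
  {v | ∃ p : ι → Poly2, G.IsPiecewise v p ∧ (∀ i, (p i).totalDegree ≤ 2) ∧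
    (∀ a i j, (G.cell i).IsVertex a → (G.cell j).IsVertex a → (p i).evalAt a = (p j).evalAt a) ∧
    (∀ a b, G.IsInteriorEdge a b → ∀ i j, (G.cell i).IsEdge a b → (G.cell j).IsEdge a b →
      edgeIntegral ((p i).dirDeriv (edgeNormal a b)) a b =
        edgeIntegral ((p j).dirDeriv (edgeNormal a b)) a b)}

/-- The homogeneous reduced quadrilateral Morley space: moreover the values at boundary vertices
and the integrals of the normal derivative over boundary edges vanish. -/
def RQM0 (G : QuadMesh Ω ι) : Set (L2 Ω) :=
  {v | v ∈ G.RQM ∧ ∃ p : ι → Poly2, G.IsPiecewise v p ∧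
    (∀ a ∈ frontier Ω, ∀ i, (G.cell i).IsVertex a → (p i).evalAt a = 0) ∧
    (∀ a b, G.IsBoundaryEdge a b → ∀ i, (G.cell i).IsEdge a b →
      edgeIntegral ((p i).dirDeriv (edgeNormal a b)) a b = 0)}

/-- The Park–Sheen space: piecewise linear functions with edge means continuous across interior
edges. -/
def PS (G : QuadMesh Ω ι) : Set (L2 Ω) :=
  {w | ∃ p : ι → Poly2, G.IsPiecewise w p ∧ (∀ i, (p i).totalDegree ≤ 1) ∧
    (∀ a b, G.IsInteriorEdge a b → ∀ i j, (G.cell i).IsEdge a b → (G.cell j).IsEdge a b →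
      edgeMean (p i).evalAt a b = edgeMean (p j).evalAt a b)}

/-- The homogeneous Park–Sheen space: moreover the means over boundary edges vanish. -/
def PS0 (G : QuadMesh Ω ι) : Set (L2 Ω) :=
  {w | w ∈ G.PS ∧ ∃ p : ι → Poly2, G.IsPiecewise w p ∧
    (∀ a b, G.IsBoundaryEdge a b → ∀ i, (G.cell i).IsEdge a b → edgeMean (p i).evalAt a b = 0)}

/-- The vector field `w` is the cell by cell curl of the piecewise polynomial function `v`. -/
def IsCurl (G : QuadMesh Ω ι) (v : L2 Ω) (w : Fin 2 → L2 Ω) : Prop :=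
  ∃ p : ι → Poly2, G.IsPiecewise v p ∧ ∀ c, G.IsPiecewise (w c) (fun i => (p i).curl c)

/-- The piecewise polynomial vector field `w` has zero divergence on each cell. -/
def IsDivFree (G : QuadMesh Ω ι) (w : Fin 2 → L2 Ω) : Prop :=
  ∃ p : Fin 2 → ι → Poly2, (∀ c, G.IsPiecewise (w c) (p c)) ∧
    ∀ i, Poly2.div (fun c => p c i) = 0

/-- The piecewise divergence-free fields in the vector Park–Sheen space `(PS0)²`. -/
def divFreePS0 (G : QuadMesh Ω ι) : Set (Fin 2 → L2 Ω) :=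
  {w | (∀ c, w c ∈ G.PS0) ∧ G.IsDivFree w}

/-- The image of a set of piecewise polynomial functions under the cell by cell curl. -/
def curlImage (G : QuadMesh Ω ι) (V : Set (L2 Ω)) : Set (Fin 2 → L2 Ω) :=
  {w | ∃ v ∈ V, G.IsCurl v w}

end QuadMesh

end

/-!
On an edge from `a` to `b`, the two components of the edge mean of `curl p` are, up to scaling, the
difference `p b - p a` and the integral of the normal derivative of `p`. Hence `curl` maps the
Morley space into the divergence-free Park–Sheen space. Conversely, a divergence-free linear field
on a cell is the curl of a quadratic stream function, unique up to an additive constant, and what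
has to be shown is that the constants can be chosen so that the vertex values match and vanish on
the boundary. Replace the stream function on each cell by any function interpolating its vertex
values linearly along the edges. Two such functions then differ by a constant where two cells meet,
and each is locally constant on `∂Ω`. Together with the zero function on the complement of `Ω` they
are local data, with closed connected pieces, for a covering of the plane. The plane is simply
connected, so this covering has a section, which provides the constants. The complement of `Ω`
has to be connected for its piece to receive a single constant; this follows from simple
connectedness of `Ω`: otherwise a bounded piece of the complement would contain a point `a`
for which a logarithm of `z - a` on `Ω` could be extended over a large circle.
-/

open Filter Topology

section Gluing

variable {X A : Type*} [TopologicalSpace X] [AddCommGroup A]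

/-- The covering space of `X` whose sections over `U x` are the functions that differ from the
local datum `φ x` by a locally constant function. The fibre is the discrete group `A`, and the
point `v` of the fibre over `z`, read in the chart `x`, stands for the value `v + φ x z`. -/
def gluingCore [TopologicalSpace A] [DiscreteTopology A] (U : X → Set X) (φ : X → X → A)
    (hU : ∀ x, IsOpen (U x)) (hmem : ∀ x, x ∈ U x)
    (hφ : ∀ x y, ∀ z ∈ U x ∩ U y, ∀ᶠ z' in 𝓝 z, φ x z' - φ y z' = φ x z - φ y z) :
    FiberBundleCore X X A where
  baseSet := U
  isOpen_baseSet := hU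
  indexAt := id
  mem_baseSet_at := hmem
  coordChange x y z v := v + (φ x z - φ y z)
  coordChange_self := by intros; simp
  continuousOn_coordChange := by
    rintro x y ⟨z, v⟩ ⟨hz, -⟩
    refine ContinuousAt.continuousWithinAt ?_
    rw [ContinuousAt, nhds_discrete A, tendsto_pure, nhds_prod_eq, nhds_discrete A]
    refine ((hφ x y z hz).prod_mk (eventually_pure.2 (rfl : v = v) : ∀ᶠ w in pure v, w = v)).mono ?_
    rintro ⟨z', w⟩ ⟨hz', rfl⟩
    simp only [hz']
  coordChange_comp := by intros; abel

theorem exists_locally_constant_sub [SimplyConnectedSpace X] [LocallyPathConnectedSpace X]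
    (U : X → Set X) (φ : X → X → A) (hU : ∀ x, IsOpen (U x)) (hmem : ∀ x, x ∈ U x)
    (hφ : ∀ x y, ∀ z ∈ U x ∩ U y, ∀ᶠ z' in 𝓝 z, φ x z' - φ y z' = φ x z - φ y z) :
    ∃ f : X → A, ∀ x, ∀ z ∈ U x, ∀ᶠ z' in 𝓝 z, f z' - φ x z' = f z - φ x z := by
  let _ : TopologicalSpace A := ⊥
  have : DiscreteTopology A := ⟨rfl⟩
  let Z := gluingCore U φ hU hmem hφ
  obtain ⟨x₀⟩ : Nonempty X := inferInstance
  have hcov : IsCoveringMap Z.proj :=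
    IsFiberBundle.isCoveringMap (F := A) fun x => ⟨Z.localTriv x, hmem x⟩
  obtain ⟨s, ⟨-, hs⟩, -⟩ := hcov.existsUnique_continuousMap_lifts (ContinuousMap.id X) x₀
    (⟨x₀, (0 : A)⟩ : Z.TotalSpace) rfl
  replace hs : ∀ z, (s z).1 = z := congrFun hs
  let σ : X → A := fun z => (s z).2
  refine ⟨fun z => σ z + φ z z, fun x z hz => ?_⟩
  have hchart : ∀ z', ((Z.localTriv x) (s z')).2 = σ z' + (φ z' z' - φ x z') := fun z' => by
    change σ z' + (φ (s z').1 (s z').1 - φ x (s z').1) = _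
    rw [hs z']
  have hcont : ContinuousAt (fun z' => ((Z.localTriv x) (s z')).2) z := by
    refine continuous_snd.continuousAt.comp
      (((Z.localTriv x).continuousAt ?_).comp s.continuous.continuousAt)
    rw [Z.mem_localTriv_source, ← Z.baseSet_at]
    exact (hs z).symm ▸ hz
  rw [ContinuousAt, nhds_discrete A, tendsto_pure] at hcont
  filter_upwards [hcont] with z' hz'
  rw [hchart, hchart] at hz'
  simpa only [add_sub_assoc] using hz'

theorem eq_of_isPreconnected_of_locally_constant {Y : Type*} {K : Set X} (hK : IsPreconnected K)
    {f : X → Y} (hf : ∀ x ∈ K, ∀ᶠ z in 𝓝[K] x, f z = f x) {x y : X} (hx : x ∈ K) (hy : y ∈ K) :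
    f x = f y := by
  let _ : TopologicalSpace Y := ⊥
  have : DiscreteTopology Y := ⟨rfl⟩
  refine hK.constant (fun z hz => ?_) hx hy
  rw [ContinuousWithinAt, nhds_discrete Y, tendsto_pure]
  exact hf z hz

variable {ι : Type*} {K : ι → Set X}

theorem eventually_nhds_sub_eq_sub (hK : ∀ i, IsClosed (K i)) (hfin : LocallyFinite K)
    {g : ι → X → A}
    (hg : ∀ i j, ∀ x ∈ K i ∩ K j, ∀ᶠ z in 𝓝[K i ∩ K j] x, g i z - g j z = g i x - g j x) (x : X) :
    ∀ᶠ z in 𝓝 x, ∀ i j, z ∈ K i → z ∈ K j → g i z - g i x = g j z - g j x := by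
  have hlocal : ∀ᶠ z in 𝓝 x, ∀ i ∈ {i | x ∈ K i}, ∀ j ∈ {i | x ∈ K i},
      z ∈ K i ∩ K j → g i z - g j z = g i x - g j x := by
    rw [(hfin.point_finite x).eventually_all]
    refine fun i hi => ((hfin.point_finite x).eventually_all).2 fun j hj => ?_
    exact eventually_nhdsWithin_iff.1 (hg i j x ⟨hi, hj⟩)
  filter_upwards [hlocal, hfin.eventually_subset hK x] with z hz hsub i j hi hj
  have := hz i (hsub hi) j (hsub hj) ⟨hi, hj⟩
  rwa [sub_eq_sub_iff_sub_eq_sub]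

theorem exists_add_const_eq_of_closed_cover [SimplyConnectedSpace X] [LocallyPathConnectedSpace X]
    (hK : ∀ i, IsClosed (K i)) (hpre : ∀ i, IsPreconnected (K i)) (hfin : LocallyFinite K)
    (hcov : ⋃ i, K i = univ) (g : ι → X → A)
    (hg : ∀ i j, ∀ x ∈ K i ∩ K j, ∀ᶠ z in 𝓝[K i ∩ K j] x, g i z - g j z = g i x - g j x) :
    ∃ C : ι → A, ∀ i j, ∀ x ∈ K i ∩ K j, g i x + C i = g j x + C j := by
  choose index hindex using fun z => mem_iUnion.1 (hcov.symm ▸ mem_univ z)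
  -- Up to a constant, `φ x` is the glued function near `x`.
  let φ : X → X → A := fun x z => g (index z) z - g (index z) x
  let U : X → Set X := fun x =>
    interior {z | ∀ i j, z ∈ K i → z ∈ K j → g i z - g i x = g j z - g j x}
  have hφ : ∀ x, ∀ z ∈ U x, ∀ i, z ∈ K i → φ x z = g i z - g i x := fun x z hz i hi =>
    interior_subset hz _ _ (hindex z) hi
  have hmem : ∀ x, x ∈ U x := fun x =>
    mem_interior_iff_mem_nhds.2 (eventually_nhds_sub_eq_sub hK hfin hg x)
  obtain ⟨f, hf⟩ := exists_locally_constant_sub U φ (fun x => isOpen_interior) hmem <| by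
    rintro x y z ⟨hx, hy⟩
    filter_upwards [isOpen_interior.eventually_mem hx, isOpen_interior.eventually_mem hy,
      hfin.eventually_subset hK z] with z' hx' hy' hsub
    have hi := hindex z'
    rw [hφ x z' hx' _ hi, hφ y z' hy' _ hi, hφ x z hx _ (hsub hi), hφ y z hy _ (hsub hi)]
    abel
  have hconst : ∀ i, ∃ C, ∀ x ∈ K i, f x = g i x + C := fun i => by
    obtain hempty | ⟨y, hy⟩ := (K i).eq_empty_or_nonempty
    · exact ⟨0, by simp [hempty]⟩
    refine ⟨f y - g i y, fun x hx => ?_⟩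
    rw [← sub_eq_iff_eq_add']
    refine eq_of_isPreconnected_of_locally_constant (hpre i) (f := fun z => f z - g i z)
      (fun x hx => eventually_nhdsWithin_iff.2 ?_) hx hy
    filter_upwards [hf x x (hmem x), isOpen_interior.eventually_mem (hmem x)] with z hz hzU hzi
    rw [hφ x z hzU i hzi, hφ x x (hmem x) i hx, sub_self, sub_zero] at hz
    rw [← hz]
    abel
  choose C hC using hconst
  exact ⟨C, fun i j x hx => (hC i x hx.1).symm.trans (hC j x hx.2)⟩

theorem eventually_eq_of_finite_closed_cover {κ Y : Type*} [Finite κ] {S : κ → Set X} {L : Set X}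
    (hS : ∀ k, IsClosed (S k)) (hL : L ⊆ ⋃ k, S k) {f : X → Y}
    (hf : ∀ k, ∀ y ∈ S k, ∀ z ∈ S k, f y = f z) (x : X) : ∀ᶠ z in 𝓝[L] x, f z = f x := by
  refine eventually_nhdsWithin_iff.2 ?_
  filter_upwards [(locallyFinite_of_finite S).eventually_subset hS x] with z hsub hz
  obtain ⟨k, hk⟩ := mem_iUnion.1 (hL hz)
  exact hf k z hk x (hsub hk)

end Gluing

section Complement

theorem not_exists_continuousOn_sphere_exp_eq_sub {a : ℂ} {r : ℝ} (hr : 0 < r) :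
    ¬ ∃ k : ℂ → ℂ, ContinuousOn k (Metric.sphere a r) ∧
      ∀ z ∈ Metric.sphere a r, Complex.exp (k z) = z - a := by
  rintro ⟨k, hk, hexp⟩
  have hmem : ∀ θ, circleMap a r θ ∈ Metric.sphere a r := circleMap_mem_sphere a hr.le
  have hlift : (fun θ => k (circleMap a r θ)) =
      fun θ : ℝ => k (circleMap a r 0) + θ * Complex.I := by
    refine Complex.isCoveringMap_exp.eq_of_comp_eq
      (hk.comp_continuous (continuous_circleMap a r) hmem) (by fun_prop) ?_ 0 (by simp)
    ext θ
    simp only [Function.comp_apply, Complex.exp_add, hexp _ (hmem _)]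
    simp only [circleMap_sub_center, circleMap_zero, Complex.ofReal_zero, zero_mul,
      Complex.exp_zero, mul_one]
  have hperiod := congrFun hlift (2 * Real.pi)
  rw [← zero_add (2 * Real.pi), periodic_circleMap a r 0] at hperiod
  simp [Real.pi_ne_zero] at hperiod

theorem exists_continuous_exp_eq_of_disjoint {X : Type*} [TopologicalSpace X] [NormalSpace X]
    [SimplyConnectedSpace X] [LocallyPathConnectedSpace X] {A B : Set X} (hA : IsClosed A)
    (hB : IsClosed B) (hAB : Disjoint A B) {f g : X → ℂ} (hf : Continuous f)
    (hfA : ∀ x ∉ A, f x ≠ 0) (hg : ContinuousOn g (A ∪ B)ᶜ)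
    (hgf : ∀ x ∉ A ∪ B, Complex.exp (g x) = f x) :
    ∃ k : X → ℂ, Continuous k ∧ ∀ x ∈ B, Complex.exp (k x) = f x := by
  classical
  obtain ⟨W, hW, hAW, hWB⟩ :=
    normal_exists_closure_subset hA hB.isOpen_compl (subset_compl_iff_disjoint_right.2 hAB)
  have hfr : frontier W ⊆ (A ∪ B)ᶜ := by
    rintro x hx (hxA | hxB)
    · exact hx.2 (hW.interior_eq.symm ▸ hAW hxA)
    · exact hWB hx.1 hxB
  obtain ⟨G, hG⟩ := ContinuousMap.exists_restrict_eq (Y := ℂ) (isClosed_frontier (s := W))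
    ⟨(frontier W).domRestrict g, (hg.mono hfr).domRestrict⟩
  replace hG : ∀ x ∈ frontier W, G x = g x := fun x hx => congrArg (fun F => F ⟨x, hx⟩) hG
  -- Replacing `f` by `exp ∘ G` on `W` removes its zeros.
  let h : X → ℂ := W.piecewise (fun x => Complex.exp (G x)) f
  have hcont : Continuous h := by
    refine Continuous.piecewise (fun x hx => ?_) (Complex.continuous_exp.comp G.continuous) hf
    rw [hG x hx, hgf x (hfr hx)]
  have hne : ∀ x, h x ≠ 0 := fun x => by
    by_cases hx : x ∈ W
    · simp only [h, hx, piecewise_eq_of_mem, ne_eq, Complex.exp_ne_zero, not_false_eq_true]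
    · simpa only [h, hx, not_false_eq_true, piecewise_eq_of_notMem] using
        hfA x fun hxA => hx (hAW hxA)
  have huniv : IsSimplyConnected (univ : Set X) :=
    (Homeomorph.Set.univ X).toHomotopyEquiv.simplyConnectedSpace_iff.2 inferInstance
  obtain ⟨k, hk, hkh⟩ := Complex.exists_continuousOn_eqOn_exp_comp huniv isOpen_univ
    hcont.continuousOn (by simpa using hne)
  refine ⟨k, continuousOn_univ.1 hk, fun x hx => (hkh (mem_univ x)).trans ?_⟩
  exact piecewise_eq_of_notMem _ _ _ fun hxW => hWB (subset_closure hxW) hx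

theorem isPreconnected_setOf_lt_norm {R : ℝ} (hR : 0 < R) : IsPreconnected {z : ℂ | R < ‖z‖} := by
  have himage : {z : ℂ | R < ‖z‖} = Complex.exp '' {w | Real.log R < w.re} := by
    ext z
    constructor
    · intro hz
      have hz0 : z ≠ 0 := norm_pos_iff.1 (hR.trans hz)
      refine ⟨Complex.log z, ?_, Complex.exp_log hz0⟩
      simpa only [mem_ofPred_eq, Complex.log_re] using Real.log_lt_log hR hz
    · rintro ⟨w, hw, rfl⟩
      rw [mem_ofPred_eq, Complex.norm_exp]
      exact (Real.log_lt_iff_lt_exp hR).1 hw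
  rw [himage]
  exact (convex_halfSpace_re_gt _).isPreconnected.image _ Complex.continuous_exp.continuousOn

theorem isPreconnected_compl_of_isSimplyConnected_complex {Ω : Set ℂ} (hsc : IsSimplyConnected Ω)
    (hΩ : IsOpen Ω) (hbd : Bornology.IsBounded Ω) : IsPreconnected Ωᶜ := by
  obtain ⟨R, hR, hΩR⟩ := hbd.subset_closedBall_lt 0 0
  have hext : {z : ℂ | R < ‖z‖} ⊆ Ωᶜ := fun z hz hzΩ =>
    hz.not_ge (mem_closedBall_zero_iff.1 (hΩR hzΩ))
  rw [isPreconnected_iff_subset_of_fully_disjoint_closed hΩ.isClosed_compl]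
  intro A B hA hB hsub hAB
  wlog hextB : {z : ℂ | R < ‖z‖} ⊆ B generalizing A B
  · refine (this B A hB hA (union_comm A B ▸ hsub) hAB.symm ?_).symm
    exact ((isPreconnected_iff_subset_of_disjoint_closed.1 (isPreconnected_setOf_lt_norm hR)) A B
      hA hB (hext.trans hsub) (by rw [hAB.inter_eq, inter_empty])).resolve_right hextB
  refine Or.inr fun a ha => (hsub ha).resolve_left fun haA => ?_
  obtain ⟨g, hg, hexp⟩ := Complex.exists_continuousOn_eqOn_exp_comp hsc hΩ (g := fun z => z - a)
    (by fun_prop) (by rintro ⟨z, hz, hza⟩; exact ha (sub_eq_zero.1 hza ▸ hz))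
  have hcompl : (A ∪ B)ᶜ ⊆ Ω := compl_subset_comm.1 hsub
  obtain ⟨k, hk, hkexp⟩ := exists_continuous_exp_eq_of_disjoint hA hB hAB (f := fun z => z - a)
    (by fun_prop) (fun z hz h => hz (sub_eq_zero.1 h ▸ haA)) (hg.mono hcompl)
    fun z hz => hexp (hcompl hz)
  refine not_exists_continuousOn_sphere_exp_eq_sub (a := a) (r := R + ‖a‖ + 1) (by positivity)
    ⟨k, hk.continuousOn, fun z hz => hkexp z (hextB ?_)⟩
  have hnorm := norm_sub_le z a
  rw [mem_sphere_iff_norm.1 hz] at hnorm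
  rw [mem_ofPred_eq]
  linarith

theorem isPreconnected_compl_of_isSimplyConnected {Ω : Set Plane} (hsc : IsSimplyConnected Ω)
    (hΩ : IsOpen Ω) (hbd : Bornology.IsBounded Ω) : IsPreconnected Ωᶜ := by
  let e : ℂ ≃ₗᵢ[ℝ] Plane := Complex.orthonormalBasisOneI.repr
  have h := (isPreconnected_compl_of_isSimplyConnected_complex (Ω := e ⁻¹' Ω)
    (e.toHomeomorph.isSimplyConnected_preimage.2 hsc) (hΩ.preimage e.continuous)
    (e.isometry.antilipschitz.isBounded_preimage hbd)).image e e.continuous.continuousOn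
  rwa [← preimage_compl, image_preimage_eq _ e.surjective] at h

end Complement

section AffineForms

section

variable {E : Type*} [AddCommGroup E] [Module ℝ E]

theorem affineMap_lineMap_apply (f : E →ᵃ[ℝ] ℝ) (a b : E) (t : ℝ) :
    f (AffineMap.lineMap a b t) = (1 - t) * f a + t * f b := by
  rw [AffineMap.apply_lineMap, AffineMap.lineMap_apply_ring]

theorem affineMap_pos_of_mem_openSegment {f : E →ᵃ[ℝ] ℝ} {a b y : E} (ha : 0 ≤ f a) (hb : 0 ≤ f b)
    (hab : 0 < f a ∨ 0 < f b) (hy : y ∈ openSegment ℝ a b) : 0 < f y := by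
  rw [openSegment_eq_image_lineMap] at hy
  obtain ⟨t, ⟨ht0, ht1⟩, rfl⟩ := hy
  rw [affineMap_lineMap_apply]
  replace ht1 := sub_pos.2 ht1
  obtain _ | _ := hab <;> positivity

theorem affineMap_eq_zero_of_mem_segment {f : E →ᵃ[ℝ] ℝ} {a b y : E} (ha : f a = 0) (hb : f b = 0)
    (hy : y ∈ segment ℝ a b) : f y = 0 := by
  rw [segment_eq_image_lineMap] at hy
  obtain ⟨t, -, rfl⟩ := hy
  rw [affineMap_lineMap_apply, ha, hb, mul_zero, mul_zero, add_zero]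

theorem frequently_affineMap_pos [TopologicalSpace E] [IsTopologicalAddGroup E] [ContinuousSMul ℝ E]
    {f : E →ᵃ[ℝ] ℝ} {y w : E} (hy : f y = 0) (hw : f w ≠ 0) : ∃ᶠ z in 𝓝 y, 0 < f z := by
  have hlim : Tendsto (fun ε => AffineMap.lineMap y w (ε * f w)) (𝓝[>] (0 : ℝ)) (𝓝 y) := by
    have hcont : Continuous fun ε : ℝ => AffineMap.lineMap y w (ε * f w) := by
      simp only [AffineMap.lineMap_apply, vsub_eq_sub, vadd_eq_add]
      fun_prop
    simpa using (hcont.tendsto 0).mono_left nhdsWithin_le_nhds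
  refine hlim.frequently (Eventually.frequently ?_)
  filter_upwards [self_mem_nhdsWithin] with ε hε
  rw [affineMap_lineMap_apply, hy, mul_zero, zero_add, mul_assoc]
  exact mul_pos hε (mul_self_pos.2 hw)

end

theorem addHaar_segment_eq_zero {E : Type*} [NormedAddCommGroup E] [NormedSpace ℝ E]
    [MeasurableSpace E] [BorelSpace E] [FiniteDimensional ℝ E] (μ : Measure E) [μ.IsAddHaarMeasure]
    (hE : 1 < Module.finrank ℝ E) (a b : E) : μ (segment ℝ a b) = 0 := by
  refine measure_mono_null (t := line[ℝ, a, b]) ?_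
    (Measure.addHaar_affineSubspace μ _ fun htop => ?_)
  · exact (convexHull_pair (𝕜 := ℝ) a b).symm.subset.trans (convexHull_subset_affineSpan _)
  · have hrank := collinear_iff_finrank_le_one.1 (collinear_pair ℝ a b)
    rw [← direction_affineSpan, htop, AffineSubspace.direction_top, finrank_top] at hrank
    exact hE.not_ge hrank

/-- The affine function `x ↦ (b - a) × (x - a)`: twice the signed area of the triangle `a b x`,
hence positive to the left of the line from `a` to `b`. -/
def lineForm (a b : Plane) : Plane →ᵃ[ℝ] ℝ where
  toFun x := cross (b - a) (x - a)
  linear :=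
    { toFun := cross (b - a)
      map_add' := fun x y => by simp only [cross, PiLp.add_apply]; ring
      map_smul' := fun r x => by
        simp only [cross, PiLp.smul_apply, smul_eq_mul, RingHom.id_apply]; ring }
  map_vadd' p v := by
    simp only [cross, PiLp.sub_apply, vadd_eq_add, PiLp.add_apply, LinearMap.coe_mk, AddHom.coe_mk]
    ring

theorem lineForm_apply (a b x : Plane) :
    lineForm a b x = (b 0 - a 0) * (x 1 - a 1) - (b 1 - a 1) * (x 0 - a 0) :=
  rfl

theorem lineForm_swap (a b : Plane) : lineForm b a = -lineForm a b := by
  ext x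
  simp only [lineForm_apply, AffineMap.coe_neg, Pi.neg_apply]
  ring

theorem lineForm_rotate (a b c : Plane) : lineForm b c a = lineForm a b c := by
  simp only [lineForm_apply]
  ring

theorem lineForm_left (a b : Plane) : lineForm a b a = 0 := by simp [lineForm_apply]

theorem lineForm_right (a b : Plane) : lineForm a b b = 0 := by simp [lineForm_apply, mul_comm]

theorem exists_lineMap_eq_of_lineForm_eq_zero {a b x : Plane} (hab : a ≠ b)
    (hx : lineForm a b x = 0) : ∃ t : ℝ, AffineMap.lineMap a b t = x := by
  have hcoord : b 0 - a 0 ≠ 0 ∨ b 1 - a 1 ≠ 0 := by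
    by_contra! h
    exact hab (PiLp.ext (Fin.forall_fin_two.2
      ⟨(sub_eq_zero.1 h.1).symm, (sub_eq_zero.1 h.2).symm⟩))
  rw [lineForm_apply] at hx
  have hcomb : ∀ t : ℝ, (∀ c, t * (b c - a c) = x c - a c) → AffineMap.lineMap a b t = x :=
    fun t ht => PiLp.ext fun c => by
      simp only [AffineMap.lineMap_apply, vsub_eq_sub, vadd_eq_add, PiLp.add_apply, PiLp.smul_apply,
        PiLp.sub_apply, smul_eq_mul, ht, sub_add_cancel]
  obtain h | h := hcoord
  · refine ⟨_, hcomb ((x 0 - a 0) / (b 0 - a 0)) (Fin.forall_fin_two.2 ⟨div_mul_cancel₀ _ h, ?_⟩)⟩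
    rw [div_mul_eq_mul_div, div_eq_iff h]
    linear_combination -hx
  · refine ⟨_, hcomb ((x 1 - a 1) / (b 1 - a 1)) (Fin.forall_fin_two.2 ⟨?_, div_mul_cancel₀ _ h⟩)⟩
    rw [div_mul_eq_mul_div, div_eq_iff h]
    linear_combination hx

/-- The barycentric coordinates of `x` are the ratios of its three line forms to that of `c`. -/
theorem mem_convexHull_triangle {a b c x : Plane} (hc : 0 < lineForm a b c)
    (hab : 0 ≤ lineForm a b x) (hbc : 0 ≤ lineForm b c x) (hca : 0 ≤ lineForm c a x) :
    x ∈ convexHull ℝ {a, b, c} := by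
  have hsum : lineForm b c x + lineForm c a x + lineForm a b x = lineForm a b c := by
    simp only [lineForm_apply]
    ring
  refine mem_convexHull_of_exists_fintype
    ![lineForm b c x / lineForm a b c, lineForm c a x / lineForm a b c,
      lineForm a b x / lineForm a b c] ![a, b, c] ?_ ?_ ?_ ?_
  · simpa only [Fin.forall_fin_succ, IsEmpty.forall_iff, and_true] using
      ⟨div_nonneg hbc hc.le, div_nonneg hca hc.le, div_nonneg hab hc.le⟩
  · simp only [Fin.sum_univ_three, Matrix.cons_val]
    rw [← add_div, ← add_div, hsum, div_self hc.ne']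
  · simp [Fin.forall_fin_succ]
  · ext c
    simp only [Fin.sum_univ_three, Matrix.cons_val, PiLp.add_apply, PiLp.smul_apply, smul_eq_mul]
    field_simp
    fin_cases c <;> simp only [lineForm_apply, Fin.zero_eta, Fin.mk_one] <;> ring

end AffineForms

namespace ConvexQuad

variable (Q : ConvexQuad)

theorem isCompact_carrier : IsCompact Q.carrier := (finite_range _).isCompact_convexHull ℝ

theorem isClosed_carrier : IsClosed Q.carrier := Q.isCompact_carrier.isClosed

theorem convex_carrier : Convex ℝ Q.carrier := convex_convexHull ℝ _

theorem vertex_mem_carrier (k : Fin 4) : Q.vertex k ∈ Q.carrier :=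
  subset_convexHull ℝ _ (mem_range_self k)

/-- The line form of the `k`-th edge, which is nonnegative on the quadrilateral. -/
def side (k : Fin 4) : Plane →ᵃ[ℝ] ℝ := lineForm (Q.vertex k) (Q.vertex (k + 1))

theorem side_vertex_self (k : Fin 4) : Q.side k (Q.vertex k) = 0 := lineForm_left _ _

theorem side_vertex_add_one (k : Fin 4) : Q.side k (Q.vertex (k + 1)) = 0 := lineForm_right _ _

theorem side_vertex_add_two_pos (k : Fin 4) : 0 < Q.side k (Q.vertex (k + 2)) := by
  have h := Q.ccw k
  simp only [cross, PiLp.sub_apply] at h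
  rw [side, lineForm_apply]
  linarith

theorem side_vertex_add_three_pos (k : Fin 4) : 0 < Q.side k (Q.vertex (k + 3)) := by
  have h := Q.side_vertex_add_two_pos (k + 3)
  rwa [side, show k + 3 + 1 = k by omega, show k + 3 + 2 = k + 1 by omega, ← lineForm_rotate] at h

theorem side_vertex_nonneg (k m : Fin 4) : 0 ≤ Q.side k (Q.vertex m) := by
  obtain rfl | rfl | rfl | rfl : m = k ∨ m = k + 1 ∨ m = k + 2 ∨ m = k + 3 := by omega
  · exact (Q.side_vertex_self _).ge
  · exact (Q.side_vertex_add_one _).ge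
  · exact (Q.side_vertex_add_two_pos _).le
  · exact (Q.side_vertex_add_three_pos _).le

theorem side_vertex_pos {k m : Fin 4} (hk : m ≠ k) (hk' : m ≠ k + 1) :
    0 < Q.side k (Q.vertex m) := by
  obtain rfl | rfl : m = k + 2 ∨ m = k + 3 := by omega
  · exact Q.side_vertex_add_two_pos k
  · exact Q.side_vertex_add_three_pos k

theorem vertex_ne_vertex_add_one (k : Fin 4) : Q.vertex k ≠ Q.vertex (k + 1) := fun h =>
  (Q.side_vertex_pos (k := k + 1) (m := k) (by omega) (by omega)).ne'
    (h ▸ Q.side_vertex_self (k + 1))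

/-- The diagonal from vertex `0` to vertex `2` cuts the quadrilateral into two triangles. -/
theorem mem_carrier_iff {x : Plane} : x ∈ Q.carrier ↔ ∀ k, 0 ≤ Q.side k x := by
  constructor
  · intro hx k
    refine convexHull_min ?_ ((convex_Ici (0 : ℝ)).affine_preimage (Q.side k)) hx
    exact range_subset_iff.2 (Q.side_vertex_nonneg k)
  · intro hx
    have hmono : ∀ i j k, convexHull ℝ {Q.vertex i, Q.vertex j, Q.vertex k} ⊆ Q.carrier :=
      fun i j k => convexHull_mono (by simp [insert_subset_iff])
    obtain h | h := le_total 0 (lineForm (Q.vertex 2) (Q.vertex 0) x)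
    · exact hmono 0 1 2 (mem_convexHull_triangle (Q.side_vertex_add_two_pos 0) (hx 0) (hx 1) h)
    · rw [lineForm_swap, AffineMap.coe_neg, Pi.neg_apply, Left.neg_nonpos_iff] at h
      exact hmono 2 3 0 (mem_convexHull_triangle (Q.side_vertex_add_two_pos 2) (hx 2) (hx 3) h)

theorem segment_subset_carrier (k : Fin 4) :
    segment ℝ (Q.vertex k) (Q.vertex (k + 1)) ⊆ Q.carrier :=
  Q.convex_carrier.segment_subset (Q.vertex_mem_carrier _) (Q.vertex_mem_carrier _)

theorem side_pos_of_mem_openSegment {k m : Fin 4} (hm : m ≠ k) {y : Plane}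
    (hy : y ∈ openSegment ℝ (Q.vertex k) (Q.vertex (k + 1))) : 0 < Q.side m y := by
  refine affineMap_pos_of_mem_openSegment (Q.side_vertex_nonneg _ _) (Q.side_vertex_nonneg _ _)
    ?_ hy
  by_cases h : k = m + 1
  · exact Or.inr (Q.side_vertex_pos (by omega) (by omega))
  · exact Or.inl (Q.side_vertex_pos hm.symm h)

theorem side_eq_zero_of_mem_segment {k : Fin 4} {y : Plane}
    (hy : y ∈ segment ℝ (Q.vertex k) (Q.vertex (k + 1))) : Q.side k y = 0 :=
  affineMap_eq_zero_of_mem_segment (Q.side_vertex_self k) (Q.side_vertex_add_one k) hy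

theorem eq_of_mem_openSegment_of_mem_segment {k m : Fin 4} {y : Plane}
    (hk : y ∈ openSegment ℝ (Q.vertex k) (Q.vertex (k + 1)))
    (hm : y ∈ segment ℝ (Q.vertex m) (Q.vertex (m + 1))) : m = k := by
  by_contra hmk
  exact (Q.side_pos_of_mem_openSegment hmk hk).ne' (Q.side_eq_zero_of_mem_segment hm)

theorem mem_segment_of_side_eq_zero {k : Fin 4} {y : Plane} (hy : y ∈ Q.carrier)
    (hside : Q.side k y = 0) : y ∈ segment ℝ (Q.vertex k) (Q.vertex (k + 1)) := by
  obtain ⟨t, rfl⟩ := exists_lineMap_eq_of_lineForm_eq_zero (Q.vertex_ne_vertex_add_one k) hside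
  have hnext := Q.mem_carrier_iff.1 hy (k + 1)
  have hprev := Q.mem_carrier_iff.1 hy (k + 3)
  rw [affineMap_lineMap_apply, Q.side_vertex_self, mul_zero, add_zero] at hnext
  rw [affineMap_lineMap_apply, show Q.vertex k = Q.vertex (k + 3 + 1) by congr; omega,
    Q.side_vertex_add_one, mul_zero, zero_add] at hprev
  rw [segment_eq_image_lineMap]
  refine ⟨t, ⟨?_, ?_⟩, rfl⟩
  · exact nonneg_of_mul_nonneg_left hprev (Q.side_vertex_pos (by omega) (by omega))
  · exact sub_nonneg.1 (nonneg_of_mul_nonneg_left hnext (Q.side_vertex_pos (by omega) (by omega)))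

theorem mem_interior_carrier_of_side_pos {x : Plane} (hx : ∀ k, 0 < Q.side k x) :
    x ∈ interior Q.carrier := by
  have hopen : IsOpen {x | ∀ k, 0 < Q.side k x} := by
    simp only [ofPred_forall]
    exact isOpen_iInter_of_finite fun k =>
      isOpen_lt continuous_const (Q.side k).continuous_of_finiteDimensional
  exact interior_maximal (fun y (hy : ∀ k, 0 < Q.side k y) =>
    Q.mem_carrier_iff.2 fun k => (hy k).le) hopen hx

theorem nonempty_interior_carrier : (interior Q.carrier).Nonempty := by
  -- Apart from its end points, a diagonal lies in the interior.
  refine ⟨midpoint ℝ (Q.vertex 0) (Q.vertex 2), Q.mem_interior_carrier_of_side_pos fun k => ?_⟩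
  refine affineMap_pos_of_mem_openSegment (Q.side_vertex_nonneg _ _) (Q.side_vertex_nonneg _ _) ?_
    (midpoint_mem_openSegment _ _)
  by_cases h : 0 = k ∨ 0 = k + 1
  · exact Or.inr (Q.side_vertex_pos (by omega) (by omega))
  · exact Or.inl (Q.side_vertex_pos (by tauto) (by tauto))

theorem isVertex_or_mem_openSegment_of_notMem_interior {y : Plane} (hy : y ∈ Q.carrier)
    (hint : y ∉ interior Q.carrier) :
    Q.IsVertex y ∨ ∃ k, y ∈ openSegment ℝ (Q.vertex k) (Q.vertex (k + 1)) := by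
  obtain ⟨k, hk⟩ : ∃ k, Q.side k y ≤ 0 := by
    by_contra! hpos
    exact hint (Q.mem_interior_carrier_of_side_pos hpos)
  have hseg := Q.mem_segment_of_side_eq_zero hy (hk.antisymm (Q.mem_carrier_iff.1 hy k))
  rw [← insert_endpoints_openSegment] at hseg
  obtain rfl | rfl | hopen := hseg
  exacts [Or.inl ⟨k, rfl⟩, Or.inl ⟨k + 1, rfl⟩, Or.inr ⟨k, hopen⟩]

theorem vertex_notMem_openSegment (m k : Fin 4) :
    Q.vertex m ∉ openSegment ℝ (Q.vertex k) (Q.vertex (k + 1)) := fun hm => by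
  have hself := Q.eq_of_mem_openSegment_of_mem_segment hm (left_mem_segment ℝ _ _)
  have hprev := Q.eq_of_mem_openSegment_of_mem_segment (m := m + 3) hm
    (by rw [show m + 3 + 1 = m by omega]; exact right_mem_segment ℝ _ _)
  omega

variable {Q} {a b : Plane}

theorem IsVertex.mem_carrier (h : Q.IsVertex a) : a ∈ Q.carrier := by
  obtain ⟨k, rfl⟩ := h
  exact Q.vertex_mem_carrier k

theorem IsEdge.symm (h : Q.IsEdge a b) : Q.IsEdge b a := by
  obtain ⟨k, hk⟩ := h
  exact ⟨k, hk.symm⟩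

theorem IsEdge.isVertex_left (h : Q.IsEdge a b) : Q.IsVertex a := by
  obtain ⟨k, ⟨hk, -⟩ | ⟨-, hk⟩⟩ := h
  exacts [⟨k, hk⟩, ⟨k + 1, hk⟩]

theorem IsEdge.ne (h : Q.IsEdge a b) : a ≠ b := by
  obtain ⟨k, ⟨rfl, rfl⟩ | ⟨rfl, rfl⟩⟩ := h
  exacts [Q.vertex_ne_vertex_add_one k, (Q.vertex_ne_vertex_add_one k).symm]

theorem IsEdge.exists_side (h : Q.IsEdge a b) :
    ∃ k, segment ℝ a b = segment ℝ (Q.vertex k) (Q.vertex (k + 1)) ∧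
      openSegment ℝ a b = openSegment ℝ (Q.vertex k) (Q.vertex (k + 1)) ∧
      (Q.side k = lineForm a b ∨ Q.side k = -lineForm a b) := by
  obtain ⟨k, ⟨rfl, rfl⟩ | ⟨rfl, rfl⟩⟩ := h
  · exact ⟨k, rfl, rfl, Or.inl rfl⟩
  · exact ⟨k, segment_symm .., openSegment_symm .., Or.inr (lineForm_swap _ _)⟩

theorem eventually_mem_carrier_iff {k : Fin 4} {y : Plane}
    (hy : y ∈ openSegment ℝ (Q.vertex k) (Q.vertex (k + 1))) :
    ∀ᶠ z in 𝓝 y, (z ∈ Q.carrier ↔ 0 ≤ Q.side k z) := by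
  have hpos : ∀ᶠ z in 𝓝 y, ∀ m, m ≠ k → 0 < Q.side m z := by
    simp only [eventually_all]
    exact fun m hm => (Q.side m).continuous_of_finiteDimensional.continuousAt.eventually_const_lt
      (Q.side_pos_of_mem_openSegment hm hy)
  filter_upwards [hpos] with z hz
  refine Q.mem_carrier_iff.trans ⟨fun h => h k, fun h m => ?_⟩
  obtain rfl | hm := eq_or_ne m k
  exacts [h, (hz m hm).le]

theorem frequently_notMem_carrier {k : Fin 4} {y : Plane}
    (hy : y ∈ openSegment ℝ (Q.vertex k) (Q.vertex (k + 1))) : ∃ᶠ z in 𝓝 y, z ∉ Q.carrier := by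
  have hneg : ∃ᶠ z in 𝓝 y, 0 < (-Q.side k) z := by
    refine frequently_affineMap_pos (w := Q.vertex (k + 2)) ?_ ?_
    · simpa using Q.side_eq_zero_of_mem_segment (openSegment_subset_segment ℝ _ _ hy)
    · simpa using (Q.side_vertex_add_two_pos k).ne'
  refine (hneg.and_eventually (eventually_mem_carrier_iff hy)).mono fun z hz hmem => ?_
  exact (neg_pos.1 hz.1).not_ge (hz.2.1 hmem)

/-- Two quadrilaterals on the same side of a common edge would overlap. -/
theorem union_carrier_mem_nhds {Q' : ConvexQuad} (h : Q.IsEdge a b) (h' : Q'.IsEdge a b)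
    (hinter : Q.carrier ∩ Q'.carrier = segment ℝ a b) {y : Plane} (hy : y ∈ openSegment ℝ a b) :
    Q.carrier ∪ Q'.carrier ∈ 𝓝 y := by
  obtain ⟨k, hseg, hopen, hform⟩ := h.exists_side
  obtain ⟨k', -, hopen', hform'⟩ := h'.exists_side
  have hQ := eventually_mem_carrier_iff (hopen ▸ hy)
  have hQ' := eventually_mem_carrier_iff (hopen' ▸ hy)
  have hsign : Q'.side k' = Q.side k ∨ Q'.side k' = -Q.side k := by
    obtain h₁ | h₁ := hform <;> obtain h₂ | h₂ := hform' <;> simp [h₁, h₂]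
  obtain hsame | hopp := hsign
  · have hpos : ∃ᶠ z in 𝓝 y, 0 < Q.side k z :=
      frequently_affineMap_pos (w := Q.vertex (k + 2))
        (Q.side_eq_zero_of_mem_segment (hseg ▸ openSegment_subset_segment ℝ _ _ hy))
        (Q.side_vertex_add_two_pos k).ne'
    obtain ⟨z, hz, hzQ, hzQ'⟩ := (hpos.and_eventually (hQ.and hQ')).exists
    have hmem : z ∈ segment ℝ a b := hinter ▸ ⟨hzQ.2 hz.le, hzQ'.2 (hsame ▸ hz.le)⟩
    exact absurd (Q.side_eq_zero_of_mem_segment (hseg ▸ hmem)) hz.ne'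
  · filter_upwards [hQ, hQ'] with z hz hz'
    rw [hopp, AffineMap.coe_neg, Pi.neg_apply, Left.nonneg_neg_iff] at hz'
    exact (le_total 0 (Q.side k z)).imp hz.2 hz'.2

variable (Q)

/-- The boundary of a quadrilateral, parametrised edge by edge; the end point of an edge is left to
the next edge, which makes the parametrisation injective. -/
noncomputable def boundaryPoint (s : Fin 4 × Ico (0 : ℝ) 1) : Plane :=
  AffineMap.lineMap (Q.vertex s.1) (Q.vertex (s.1 + 1)) (s.2 : ℝ)

theorem side_boundaryPoint_self (s : Fin 4 × Ico (0 : ℝ) 1) :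
    Q.side s.1 (Q.boundaryPoint s) = 0 := by
  rw [boundaryPoint, affineMap_lineMap_apply, side_vertex_self, side_vertex_add_one, mul_zero,
    mul_zero, add_zero]

theorem side_boundaryPoint_pos {m : Fin 4} {s : Fin 4 × Ico (0 : ℝ) 1}
    (hm : m = s.1 + 1 ∨ m = s.1 + 2) : 0 < Q.side m (Q.boundaryPoint s) := by
  obtain ⟨k, t, ht0, ht1⟩ := s
  have hk : 0 < Q.side m (Q.vertex k) := Q.side_vertex_pos (by grind) (by grind)
  have hk' := Q.side_vertex_nonneg m (k + 1)
  have := sub_pos.2 ht1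
  rw [boundaryPoint, affineMap_lineMap_apply]
  positivity

theorem boundaryPoint_injective : Function.Injective Q.boundaryPoint := by
  intro s s' h
  have hfst : s.1 = s'.1 := by
    have hs : ∀ {m}, m = s.1 + 1 ∨ m = s.1 + 2 → s'.1 ≠ m := fun hm hm' =>
      (Q.side_boundaryPoint_pos hm).ne' (h ▸ hm' ▸ Q.side_boundaryPoint_self s')
    have hs' : ∀ {m}, m = s'.1 + 1 ∨ m = s'.1 + 2 → s.1 ≠ m := fun hm hm' =>
      (Q.side_boundaryPoint_pos hm).ne' (h ▸ hm' ▸ Q.side_boundaryPoint_self s)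
    grind
  obtain ⟨k, t⟩ := s
  obtain ⟨k', t'⟩ := s'
  obtain rfl : k = k' := hfst
  exact Prod.ext rfl (Subtype.ext (AffineMap.lineMap_injective ℝ (Q.vertex_ne_vertex_add_one k) h))

/-- On each edge of `Q` the function `g` interpolates linearly between the values of `q` at the end
points. Off the boundary of `Q` nothing is required: cells only meet along their boundaries. -/
def InterpolatesEdges (q g : Plane → ℝ) : Prop :=
  ∀ a b, Q.IsEdge a b → ∀ t ∈ Icc (0 : ℝ) 1,
    g (AffineMap.lineMap a b t) = AffineMap.lineMap (q a) (q b) t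

theorem exists_interpolatesEdges (q : Plane → ℝ) : ∃ g, Q.InterpolatesEdges q g := by
  let g := Function.extend Q.boundaryPoint
    (fun s => AffineMap.lineMap (q (Q.vertex s.1)) (q (Q.vertex (s.1 + 1))) (s.2 : ℝ)) 0
  have hIco : ∀ k, ∀ t ∈ Ico (0 : ℝ) 1, g (AffineMap.lineMap (Q.vertex k) (Q.vertex (k + 1)) t) =
      AffineMap.lineMap (q (Q.vertex k)) (q (Q.vertex (k + 1))) t := fun k t ht =>
    Q.boundaryPoint_injective.extend_apply _ _ (k, ⟨t, ht⟩)
  have hIcc : ∀ k, ∀ t ∈ Icc (0 : ℝ) 1, g (AffineMap.lineMap (Q.vertex k) (Q.vertex (k + 1)) t) =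
      AffineMap.lineMap (q (Q.vertex k)) (q (Q.vertex (k + 1))) t := fun k t ht => by
    obtain rfl | ht1 := ht.2.eq_or_lt
    · simpa using hIco (k + 1) 0 ⟨le_rfl, one_pos⟩
    · exact hIco k t ⟨ht.1, ht1⟩
  refine ⟨g, ?_⟩
  rintro a b ⟨k, ⟨rfl, rfl⟩ | ⟨rfl, rfl⟩⟩ t ht
  · exact hIcc k t ht
  · rw [← AffineMap.lineMap_apply_one_sub, hIcc k _ (Icc.mem_iff_one_sub_mem.1 ht),
      AffineMap.lineMap_apply_one_sub]

variable {Q} {q g : Plane → ℝ}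

theorem InterpolatesEdges.apply_vertex (hg : Q.InterpolatesEdges q g) (h : Q.IsVertex a) :
    g a = q a := by
  obtain ⟨k, rfl⟩ := h
  simpa using hg _ _ ⟨k, Or.inl ⟨rfl, rfl⟩⟩ 0 (left_mem_Icc.2 zero_le_one)

theorem InterpolatesEdges.sub_eq_of_mem_segment {Q' : ConvexQuad} {q' g' : Plane → ℝ}
    (hg : Q.InterpolatesEdges q g) (hg' : Q'.InterpolatesEdges q' g') (h : Q.IsEdge a b)
    (h' : Q'.IsEdge a b) (hq : q b - q a = q' b - q' a) {y : Plane} (hy : y ∈ segment ℝ a b) :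
    g y - g' y = q a - q' a := by
  rw [segment_eq_image_lineMap] at hy
  obtain ⟨t, ht, rfl⟩ := hy
  rw [hg a b h t ht, hg' a b h' t ht, AffineMap.lineMap_apply_ring', AffineMap.lineMap_apply_ring',
    hq]
  ring

theorem InterpolatesEdges.eq_of_mem_segment (hg : Q.InterpolatesEdges q g) (h : Q.IsEdge a b)
    (hq : q b - q a = 0) {y : Plane} (hy : y ∈ segment ℝ a b) : g y = q a := by
  have hzero : Q.InterpolatesEdges 0 0 := fun a b _ t _ => by simp
  simpa using hg.sub_eq_of_mem_segment hzero h h (by simpa using hq) hy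

end ConvexQuad

section PartialDerivatives

open MvPolynomial

variable {σ R K : Type*} [CommSemiring R] [Field K]

theorem pderiv_pderiv_comm (p : MvPolynomial σ R) (i j : σ) :
    pderiv i (pderiv j p) = pderiv j (pderiv i p) := by
  obtain rfl | hij := eq_or_ne i j
  · rfl
  induction p using MvPolynomial.induction_on' with
  | monomial m c =>
    simp only [pderiv_monomial, Finsupp.tsub_apply, Finsupp.single_eq_of_ne hij,
      Finsupp.single_eq_of_ne hij.symm, tsub_zero, tsub_right_comm, mul_right_comm]
  | add p q hp hq => rw [map_add, map_add, map_add, map_add, hp, hq]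

theorem totalDegree_pderiv_le (p : MvPolynomial σ R) (i : σ) :
    (pderiv i p).totalDegree ≤ p.totalDegree - 1 := by
  refine Finset.sup_le fun m hm => ?_
  rw [mem_support_iff, coeff_pderiv] at hm
  have h := le_totalDegree (mem_support_iff.2 (left_ne_zero_of_mul hm))
  rw [Finsupp.sum_add_index' (fun _ => rfl) (fun _ _ _ => rfl), Finsupp.sum_single_index rfl] at h
  exact Nat.le_sub_of_add_le h

/-- In characteristic zero, the antiderivative of a polynomial with respect to the variable `X i`
whose monomials all contain `X i`. -/
noncomputable def partialAntideriv (i : σ) : MvPolynomial σ K →ₗ[K] MvPolynomial σ K :=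
  (basisMonomials σ K).constr K fun m => monomial (m + Finsupp.single i 1) ((m i + 1 : K)⁻¹)

theorem partialAntideriv_monomial (i : σ) (m : σ →₀ ℕ) (c : K) :
    partialAntideriv i (monomial m c) = monomial (m + Finsupp.single i 1) (c / (m i + 1)) := by
  have hm : (monomial m c : MvPolynomial σ K) = c • basisMonomials σ K m := by
    rw [coe_basisMonomials, smul_monomial, smul_eq_mul, mul_one]
  rw [hm, map_smul, partialAntideriv, Module.Basis.constr_basis, smul_monomial, smul_eq_mul,
    div_eq_mul_inv]

theorem totalDegree_partialAntideriv_le (i : σ) (p : MvPolynomial σ K) :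
    (partialAntideriv i p).totalDegree ≤ p.totalDegree + 1 := by
  conv_lhs => rw [p.as_sum, map_sum]
  refine totalDegree_finsetSum_le fun m hm => ?_
  rw [partialAntideriv_monomial]
  refine (totalDegree_monomial_le _ _).trans ?_
  rw [Finsupp.sum_add_index' (fun _ => rfl) (fun _ _ _ => rfl), Finsupp.sum_single_index rfl]
  exact Nat.add_le_add_right (le_totalDegree hm) 1

theorem pderiv_partialAntideriv_self [CharZero K] (i : σ) (p : MvPolynomial σ K) :
    pderiv i (partialAntideriv i p) = p := by
  induction p using MvPolynomial.induction_on' with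
  | monomial m c =>
    rw [partialAntideriv_monomial, pderiv_monomial, add_tsub_cancel_right, Finsupp.add_apply,
      Finsupp.single_eq_same, Nat.cast_add_one, div_mul_cancel₀ c (Nat.cast_add_one_ne_zero (m i))]
  | add p q hp hq => rw [map_add, map_add, hp, hq]

theorem pderiv_partialAntideriv_of_ne {i j : σ} (hij : i ≠ j) (p : MvPolynomial σ K) :
    pderiv i (partialAntideriv j p) = partialAntideriv j (pderiv i p) := by
  induction p using MvPolynomial.induction_on' with
  | monomial m c =>
    have hexp : m + Finsupp.single j 1 - Finsupp.single i 1 =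
        m - Finsupp.single i 1 + Finsupp.single j 1 := by
      ext k
      obtain rfl | hk := eq_or_ne k i
      · simp only [Finsupp.tsub_apply, Finsupp.add_apply, Finsupp.single_eq_of_ne hij, add_zero]
      · simp only [Finsupp.tsub_apply, Finsupp.add_apply, Finsupp.single_eq_of_ne hk, tsub_zero]
    simp only [partialAntideriv_monomial, pderiv_monomial, Finsupp.add_apply, Finsupp.tsub_apply,
      Finsupp.single_eq_of_ne hij, Finsupp.single_eq_of_ne hij.symm, add_zero, tsub_zero, hexp,
      div_mul_eq_mul_div]
  | add p q hp hq => rw [map_add, map_add, map_add, map_add, hp, hq]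

end PartialDerivatives

namespace Poly2

open MvPolynomial

theorem totalDegree_curl_le (p : Poly2) (c : Fin 2) :
    (p.curl c).totalDegree ≤ p.totalDegree - 1 := by
  fin_cases c
  · exact totalDegree_pderiv_le p 1
  · exact (totalDegree_neg _).trans_le (totalDegree_pderiv_le p 0)

theorem div_curl (p : Poly2) : div p.curl = 0 := by
  simp only [div, curl, Matrix.cons_val_zero, Matrix.cons_val_one, map_neg,
    pderiv_pderiv_comm p 0 1, add_neg_cancel]

theorem curl_add_C (p : Poly2) (r : ℝ) : curl (p + C r) = curl p := by
  simp only [curl, map_add, pderiv_C, add_zero]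

theorem evalAt_add_C (p : Poly2) (r : ℝ) (x : Plane) : evalAt (p + C r) x = evalAt p x + r := by
  simp only [evalAt, map_add, eval_C]

theorem exists_curl_eq_of_div_eq_zero {p : Fin 2 → Poly2} {n : ℕ}
    (hdeg : ∀ c, (p c).totalDegree ≤ n) (hdiv : div p = 0) :
    ∃ q : Poly2, q.totalDegree ≤ n + 1 ∧ q.curl = p := by
  have hdeg_antideriv : ∀ (i : Fin 2) {r : Poly2}, r.totalDegree ≤ n →
      (partialAntideriv i r).totalDegree ≤ n + 1 := fun i r hr =>
    (totalDegree_partialAntideriv_le i r).trans (Nat.add_le_add_right hr 1)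
  let q₁ : Poly2 := partialAntideriv 1 (p 0)
  have hq₁ : q₁.totalDegree ≤ n + 1 := hdeg_antideriv 1 (hdeg 0)
  let r : Poly2 := p 1 + pderiv 0 q₁
  have hr : r.totalDegree ≤ n :=
    (totalDegree_add _ _).trans (max_le (hdeg 1)
      ((totalDegree_pderiv_le q₁ 0).trans (Nat.sub_le_of_le_add hq₁)))
  have hr_pderiv : pderiv 1 r = 0 := by
    rw [map_add, pderiv_pderiv_comm, pderiv_partialAntideriv_self, add_comm]
    exact hdiv
  refine ⟨q₁ - partialAntideriv 0 r,
    (totalDegree_sub _ _).trans (max_le hq₁ (hdeg_antideriv 0 hr)), ?_⟩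
  funext c
  fin_cases c
  · change pderiv 1 (q₁ - partialAntideriv 0 r) = p 0
    rw [map_sub, pderiv_partialAntideriv_self, pderiv_partialAntideriv_of_ne one_ne_zero,
      hr_pderiv, map_zero, sub_zero]
  · change -pderiv 0 (q₁ - partialAntideriv 0 r) = p 1
    rw [map_sub, pderiv_partialAntideriv_self, neg_sub, add_sub_cancel_right]

theorem continuous_evalAt (p : Poly2) : Continuous p.evalAt :=
  (MvPolynomial.continuous_eval p).comp (PiLp.continuous_ofLp 2 _)

theorem eq_of_eqOn_isOpen {p q : Poly2} {U : Set Plane} (hU : IsOpen U) (hne : U.Nonempty)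
    (h : EqOn p.evalAt q.evalAt U) : p = q := by
  obtain ⟨x, hx⟩ := hne
  have hV : IsOpen ((WithLp.toLp 2 : (Fin 2 → ℝ) → Plane) ⁻¹' U) :=
    hU.preimage (PiLp.continuous_toLp 2 _)
  obtain ⟨u, hu, hsub⟩ := isOpen_pi_iff'.1 hV (fun c => x c) hx
  exact funext_set u (fun c => infinite_of_mem_nhds _ ((hu c).1.mem_nhds (hu c).2))
    fun y hy => h (hsub hy)

theorem hasDerivAt_evalAt_lineMap (p : Poly2) (a b : Plane) (t : ℝ) :
    HasDerivAt (fun s : ℝ => p.evalAt (AffineMap.lineMap a b s))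
      (p.dirDeriv (b - a) (AffineMap.lineMap a b t)) t := by
  induction p using MvPolynomial.induction_on with
  | C r => simpa [evalAt, dirDeriv] using hasDerivAt_const t r
  | add p q hp hq =>
    convert! hp.add hq using 1
    · funext s; simp [evalAt]
    · simp only [dirDeriv, evalAt, map_add]; ring
  | mul_X p i hp =>
    have hX : HasDerivAt (fun s : ℝ => (AffineMap.lineMap a b s : Plane) i) (b i - a i) t := by
      convert! ((hasDerivAt_id t).mul_const (b i - a i)).add_const (a i) using 1
      rw [one_mul]
    convert! hp.mul hX using 1
    · funext s; simp [evalAt]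
    · fin_cases i <;> simp [evalAt, dirDeriv, pderiv_X] <;> ring

theorem dirDeriv_eq_evalAt_curl (p : Poly2) (n x : Plane) :
    p.dirDeriv n x = (p.curl 0).evalAt x * n 1 - (p.curl 1).evalAt x * n 0 := by
  simp only [dirDeriv, curl, evalAt, Matrix.cons_val_zero, Matrix.cons_val_one, map_neg]
  ring

theorem intervalIntegrable_evalAt_lineMap (p : Poly2) (a b : Plane) :
    IntervalIntegrable (fun t : ℝ => p.evalAt (AffineMap.lineMap a b t)) volume 0 1 :=
  (p.continuous_evalAt.comp AffineMap.lineMap_continuous).intervalIntegrable _ _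

theorem edgeMean_dirDeriv (p : Poly2) (n a b : Plane) :
    edgeMean (p.dirDeriv n) a b =
      edgeMean (p.curl 0).evalAt a b * n 1 - edgeMean (p.curl 1).evalAt a b * n 0 := by
  simp only [edgeMean, dirDeriv_eq_evalAt_curl]
  rw [← intervalIntegral.integral_mul_const, ← intervalIntegral.integral_mul_const,
    ← intervalIntegral.integral_sub ((intervalIntegrable_evalAt_lineMap _ a b).mul_const _)
      ((intervalIntegrable_evalAt_lineMap _ a b).mul_const _)]

theorem evalAt_sub_evalAt_eq_edgeMean (p : Poly2) (a b : Plane) :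
    p.evalAt b - p.evalAt a =
      edgeMean (p.curl 0).evalAt a b * (b 1 - a 1) -
        edgeMean (p.curl 1).evalAt a b * (b 0 - a 0) := by
  have hcont : Continuous (p.dirDeriv (b - a)) :=
    ((continuous_evalAt _).mul continuous_const).add ((continuous_evalAt _).mul continuous_const)
  have hftc := intervalIntegral.integral_eq_sub_of_hasDerivAt
    (fun t _ => hasDerivAt_evalAt_lineMap p a b t)
    ((hcont.comp AffineMap.lineMap_continuous).intervalIntegrable 0 1)
  rw [AffineMap.lineMap_apply_zero, AffineMap.lineMap_apply_one] at hftc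
  exact hftc.symm.trans (edgeMean_dirDeriv p (b - a) a b)

theorem edgeIntegral_dirDeriv_edgeNormal (p : Poly2) {a b : Plane} (hab : a ≠ b) :
    edgeIntegral (p.dirDeriv (edgeNormal a b)) a b =
      -(edgeMean (p.curl 0).evalAt a b * (b 0 - a 0) +
        edgeMean (p.curl 1).evalAt a b * (b 1 - a 1)) := by
  have hd : dist a b ≠ 0 := dist_ne_zero.2 hab
  rw [edgeIntegral, edgeMean_dirDeriv]
  simp only [edgeNormal, PiLp.smul_apply, smul_eq_mul, Matrix.cons_val_zero, Matrix.cons_val_one]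
  field_simp
  ring

/-- The difference of the end point values and the integral of the normal derivative of `p` are, up
to scaling, the normal and the tangential component of the edge mean of `curl p`. -/
theorem edgeMean_curl_eq_iff {p q : Poly2} {a b : Plane} (hab : a ≠ b) :
    (∀ c, edgeMean (p.curl c).evalAt a b = edgeMean (q.curl c).evalAt a b) ↔
      p.evalAt b - p.evalAt a = q.evalAt b - q.evalAt a ∧
        edgeIntegral (p.dirDeriv (edgeNormal a b)) a b =
          edgeIntegral (q.dirDeriv (edgeNormal a b)) a b := by
  rw [Fin.forall_fin_two, evalAt_sub_evalAt_eq_edgeMean, evalAt_sub_evalAt_eq_edgeMean,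
    edgeIntegral_dirDeriv_edgeNormal _ hab, edgeIntegral_dirDeriv_edgeNormal _ hab]
  refine ⟨fun ⟨h₀, h₁⟩ => by rw [h₀, h₁]; exact ⟨rfl, rfl⟩, fun ⟨ht, hn⟩ => ?_⟩
  have hlength : (b 0 - a 0) ^ 2 + (b 1 - a 1) ^ 2 ≠ 0 := by
    have := dist_ne_zero.2 hab
    rw [EuclideanSpace.dist_eq, Real.sqrt_ne_zero', Fin.sum_univ_two, Real.dist_eq, Real.dist_eq,
      sq_abs, sq_abs] at this
    nlinarith
  constructor <;> refine mul_left_cancel₀ hlength ?_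
  · linear_combination (b 1 - a 1) * ht - (b 0 - a 0) * hn
  · linear_combination -(b 0 - a 0) * ht - (b 1 - a 1) * hn

theorem edgeMean_curl_eq_zero_iff {p : Poly2} {a b : Plane} (hab : a ≠ b) :
    (∀ c, edgeMean (p.curl c).evalAt a b = 0) ↔
      p.evalAt b - p.evalAt a = 0 ∧ edgeIntegral (p.dirDeriv (edgeNormal a b)) a b = 0 := by
  have h := edgeMean_curl_eq_iff (p := p) (q := 0) hab
  simpa [Fin.forall_fin_two, curl, evalAt, edgeMean, edgeIntegral, dirDeriv] using h

end Poly2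

section LipschitzDomain

theorem frequently_apply_one_lt (T : Plane ≃ₗᵢ[ℝ] Plane) (f : ℝ → ℝ) {x : Plane}
    (hx : T x 1 ≤ f (T x 0)) : ∃ᶠ z in 𝓝 x, T z 1 < f (T z 0) := by
  let down : ℝ → Plane := fun ε => x - ε • T.symm !₂[0, 1]
  have hlim : Tendsto down (𝓝[>] 0) (𝓝 x) := by
    have hcont : Continuous down := by fun_prop
    simpa [down] using (hcont.tendsto 0).mono_left nhdsWithin_le_nhds
  refine hlim.frequently (Eventually.frequently ?_)
  filter_upwards [self_mem_nhdsWithin] with ε (hε : 0 < ε)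
  have h0 : T (down ε) 0 = T x 0 := by simp [down]
  have h1 : T (down ε) 1 = T x 1 - ε := by simp [down]
  rw [h0, h1]
  linarith

theorem IsLipschitzDomain.interior_closure_eq {Ω : Set Plane} (hΩ : IsLipschitzDomain Ω) :
    interior (closure Ω) = Ω := by
  refine Subset.antisymm (fun x hx => ?_) hΩ.isOpen.subset_interior_closure
  by_contra hxΩ
  obtain ⟨T, K, f, U, hf, hU, hxU, hΩU⟩ := hΩ.boundary x
    ⟨interior_subset hx, fun h => hxΩ (interior_subset h)⟩
  have hx_below : T x 1 ≤ f (T x 0) := not_lt.1 fun h => hxΩ (hΩU.superset ⟨h, hxU⟩).1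
  obtain ⟨y, hy, hyU, hyΩ⟩ := ((frequently_apply_one_lt T f hx_below).and_eventually
    ((hU.eventually_mem hxU).and (isOpen_interior.eventually_mem hx))).exists
  have hopen : IsOpen {z | T z 1 < f (T z 0)} := by
    have := T.continuous
    have := hf.continuous
    exact isOpen_lt (by fun_prop) (by fun_prop)
  obtain ⟨z, ⟨hz, hzU⟩, hzΩ⟩ := mem_closure_iff.1 (interior_subset hyΩ) _ (hopen.inter hU) ⟨hy, hyU⟩
  have hz_above : f (T z 0) < T z 1 := (hΩU.subset ⟨hzΩ, hzU⟩).1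
  exact lt_asymm hz hz_above

end LipschitzDomain

theorem Poly2.memLp_indicator_evalAt (p : Poly2) {K : Set Plane} (hK : IsCompact K)
    (μ : Measure Plane) [IsFiniteMeasureOnCompacts μ] (r : ENNReal) :
    MemLp (K.indicator p.evalAt) r μ := by
  have : IsFiniteMeasure (μ.restrict K) := ⟨by
    rw [Measure.restrict_apply_univ]
    exact hK.measure_lt_top⟩
  obtain ⟨C, hC⟩ := hK.exists_bound_of_continuousOn p.continuous_evalAt.continuousOn
  exact (memLp_indicator_iff_restrict hK.measurableSet).2 <|
    MemLp.of_bound p.continuous_evalAt.aestronglyMeasurable C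
      ((ae_restrict_mem hK.measurableSet).mono hC)

namespace QuadMesh

variable {Ω : Set Plane} {ι : Type*} (G : QuadMesh Ω ι)

theorem carrier_subset_closure (i : ι) : (G.cell i).carrier ⊆ closure Ω :=
  G.cover ▸ subset_iUnion (fun i => (G.cell i).carrier) i

theorem exists_mem_carrier {z : Plane} (hz : z ∈ closure Ω) : ∃ i, z ∈ (G.cell i).carrier :=
  mem_iUnion.1 (G.cover.symm ▸ hz)

theorem volume_inter_eq_zero {i j : ι} (hij : i ≠ j) :
    volume ((G.cell i).carrier ∩ (G.cell j).carrier) = 0 := by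
  obtain h | ⟨a, -, -, h⟩ | ⟨a, b, -, -, h⟩ := G.conforming i j hij <;> rw [h]
  · exact measure_empty
  · exact measure_singleton a
  · exact addHaar_segment_eq_zero volume (by simp) a b

theorem exists_isPiecewise [Finite ι] (p : ι → Poly2) : ∃ v : L2 Ω, G.IsPiecewise v p := by
  cases nonempty_fintype ι
  have hmem : MemLp (fun x => ∑ i, (G.cell i).carrier.indicator (p i).evalAt x) 2
      (volume.restrict Ω) :=
    memLp_finsetSum _ fun i _ => (p i).memLp_indicator_evalAt (G.cell i).isCompact_carrier _ 2
  refine ⟨hmem.toLp, fun i => ?_⟩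
  have hdisj : ∀ᵐ x ∂(volume.restrict Ω), ∀ j, j ≠ i →
      x ∉ (G.cell i).carrier ∩ (G.cell j).carrier := by
    simp only [ae_all_iff]
    exact fun j hj =>
      ae_restrict_of_ae (measure_eq_zero_iff_ae_notMem.1 (G.volume_inter_eq_zero hj.symm))
  filter_upwards [hmem.coeFn_toLp, hdisj] with x hx hdisj hxi
  rw [hx, Finset.sum_eq_single_of_mem i (Finset.mem_univ i), indicator_of_mem hxi]
  exact fun j _ hj => indicator_of_notMem (fun hxj => hdisj j hj ⟨hxi, hxj⟩) _

variable {G}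

theorem IsPiecewise.unique (hΩ : IsOpen Ω) {v : L2 Ω} {p q : ι → Poly2} (hp : G.IsPiecewise v p)
    (hq : G.IsPiecewise v q) : p = q := by
  funext i
  let U : Set Plane := interior (G.cell i).carrier ∩ Ω
  have hU : IsOpen U := isOpen_interior.inter hΩ
  have hne : U.Nonempty := by
    obtain ⟨x, hx⟩ := (G.cell i).nonempty_interior_carrier
    exact mem_closure_iff.1 (G.carrier_subset_closure i (interior_subset hx)) _ isOpen_interior hx
  refine Poly2.eq_of_eqOn_isOpen hU hne (Measure.eqOn_open_of_ae_eq (μ := volume) ?_ hU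
    (Poly2.continuous_evalAt _).continuousOn (Poly2.continuous_evalAt _).continuousOn)
  filter_upwards [ae_restrict_of_ae_restrict_of_subset inter_subset_right (hp i),
    ae_restrict_of_ae_restrict_of_subset inter_subset_right (hq i),
    ae_restrict_mem hU.measurableSet] with x hxp hxq hx
  rw [← hxp (interior_subset hx.1), ← hxq (interior_subset hx.1)]

end QuadMesh

namespace QuadMesh

variable {Ω : Set Plane} {ι : Type*} (G : QuadMesh Ω ι)

/-- The edge functional `Λ`, where `Λ i a b` is its value computed from the `i`-th cell, is
continuous across interior edges and vanishes on boundary edges. -/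
def EdgeConforming (Λ : ι → Plane → Plane → ℝ) : Prop :=
  (∀ a b, G.IsInteriorEdge a b → ∀ i j, (G.cell i).IsEdge a b → (G.cell j).IsEdge a b →
    Λ i a b = Λ j a b) ∧
  (∀ a b, G.IsBoundaryEdge a b → ∀ i, (G.cell i).IsEdge a b → Λ i a b = 0)

/-- The cellwise function `q` is continuous at the vertices and vanishes at boundary vertices. -/
def VertexConforming (q : ι → Plane → ℝ) : Prop :=
  (∀ a i j, (G.cell i).IsVertex a → (G.cell j).IsVertex a → q i a = q j a) ∧
  (∀ a ∈ frontier Ω, ∀ i, (G.cell i).IsVertex a → q i a = 0)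

section Spaces

variable {G}

theorem IsPiecewise.mem_PS0_iff (hΩ : IsOpen Ω) {w : L2 Ω} {p : ι → Poly2}
    (hp : G.IsPiecewise w p) :
    w ∈ G.PS0 ↔ (∀ i, (p i).totalDegree ≤ 1) ∧ G.EdgeConforming fun i => edgeMean (p i).evalAt := by
  constructor
  · rintro ⟨⟨p₁, hp₁, hdeg, hint⟩, p₂, hp₂, hbd⟩
    obtain rfl := hp₁.unique hΩ hp
    obtain rfl := hp₂.unique hΩ hp
    exact ⟨hdeg, hint, hbd⟩
  · rintro ⟨hdeg, hint, hbd⟩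
    exact ⟨⟨p, hp, hdeg, hint⟩, p, hp, hbd⟩

theorem IsPiecewise.mem_RQM0_iff (hΩ : IsOpen Ω) {v : L2 Ω} {p : ι → Poly2}
    (hp : G.IsPiecewise v p) :
    v ∈ G.RQM0 ↔ (∀ i, (p i).totalDegree ≤ 2) ∧ G.VertexConforming (fun i => (p i).evalAt) ∧
      G.EdgeConforming fun i a b => edgeIntegral ((p i).dirDeriv (edgeNormal a b)) a b := by
  constructor
  · rintro ⟨⟨p₁, hp₁, hdeg, hvert, hint⟩, p₂, hp₂, hvert_bd, hbd⟩
    obtain rfl := hp₁.unique hΩ hp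
    obtain rfl := hp₂.unique hΩ hp
    exact ⟨hdeg, ⟨hvert, hvert_bd⟩, hint, hbd⟩
  · rintro ⟨hdeg, ⟨hvert, hvert_bd⟩, hint, hbd⟩
    exact ⟨⟨p, hp, hdeg, hvert, hint⟩, p, hp, hvert_bd, hbd⟩

theorem mem_divFreePS0_iff (hΩ : IsOpen Ω) {w : Fin 2 → L2 Ω} :
    w ∈ G.divFreePS0 ↔ ∃ p : ι → Fin 2 → Poly2, (∀ c, G.IsPiecewise (w c) fun i => p i c) ∧
      (∀ i, Poly2.div (p i) = 0) ∧ (∀ i c, (p i c).totalDegree ≤ 1) ∧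
      ∀ c, G.EdgeConforming fun i => edgeMean (p i c).evalAt := by
  constructor
  · rintro ⟨hw, p, hp, hdiv⟩
    exact ⟨fun i c => p c i, hp, hdiv, fun i c => (((hp c).mem_PS0_iff hΩ).1 (hw c)).1 i,
      fun c => (((hp c).mem_PS0_iff hΩ).1 (hw c)).2⟩
  · rintro ⟨p, hp, hdiv, hdeg, hedge⟩
    exact ⟨fun c => ((hp c).mem_PS0_iff hΩ).2 ⟨fun i => hdeg i c, hedge c⟩,
      fun c i => p i c, hp, hdiv⟩

theorem mem_curlImage_RQM0_iff [Finite ι] (hΩ : IsOpen Ω) {w : Fin 2 → L2 Ω} :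
    w ∈ G.curlImage G.RQM0 ↔ ∃ p : ι → Poly2, (∀ c, G.IsPiecewise (w c) fun i => (p i).curl c) ∧
      (∀ i, (p i).totalDegree ≤ 2) ∧ G.VertexConforming (fun i => (p i).evalAt) ∧
      G.EdgeConforming fun i a b => edgeIntegral ((p i).dirDeriv (edgeNormal a b)) a b := by
  constructor
  · rintro ⟨v, hv, p, hp, hcurl⟩
    exact ⟨p, hcurl, (hp.mem_RQM0_iff hΩ).1 hv⟩
  · rintro ⟨p, hcurl, hmem⟩
    obtain ⟨v, hv⟩ := G.exists_isPiecewise p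
    exact ⟨v, (hv.mem_RQM0_iff hΩ).2 hmem, p, hv, hcurl⟩

end Spaces

section Edges

variable {G}

theorem EdgeConforming.eq {Λ : ι → Plane → Plane → ℝ} (hΛ : G.EdgeConforming Λ) {i j : ι}
    {a b : Plane} (hi : (G.cell i).IsEdge a b) (hj : (G.cell j).IsEdge a b) :
    Λ i a b = Λ j a b := by
  by_cases hab : segment ℝ a b ⊆ frontier Ω
  · rw [hΛ.2 a b ⟨⟨i, hi⟩, hab⟩ i hi, hΛ.2 a b ⟨⟨i, hi⟩, hab⟩ j hj]
  · exact hΛ.1 a b ⟨⟨i, hi⟩, hab⟩ i j hi hj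

theorem VertexConforming.edgeConforming_sub {q : ι → Plane → ℝ} (hq : G.VertexConforming q) :
    G.EdgeConforming fun i a b => q i b - q i a := by
  constructor
  · intro a b _ i j hi hj
    simp only [hq.1 b i j hi.symm.isVertex_left hj.symm.isVertex_left,
      hq.1 a i j hi.isVertex_left hj.isVertex_left]
  · intro a b hab i hi
    simp only [hq.2 b (hab.2 (right_mem_segment ℝ a b)) i hi.symm.isVertex_left,
      hq.2 a (hab.2 (left_mem_segment ℝ a b)) i hi.isVertex_left, sub_zero]

theorem edgeConforming_edgeMean_curl_iff {p : ι → Poly2} :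
    (∀ c, G.EdgeConforming fun i => edgeMean ((p i).curl c).evalAt) ↔
      (G.EdgeConforming fun i a b => (p i).evalAt b - (p i).evalAt a) ∧
      G.EdgeConforming fun i a b => edgeIntegral ((p i).dirDeriv (edgeNormal a b)) a b := by
  constructor
  · intro h
    have hint := fun a b hab i j hi hj =>
      (Poly2.edgeMean_curl_eq_iff (p := p i) (q := p j) (ConvexQuad.IsEdge.ne hi)).1
        fun c => (h c).1 a b hab i j hi hj
    have hbd := fun a b hab i hi =>
      (Poly2.edgeMean_curl_eq_zero_iff (p := p i) (ConvexQuad.IsEdge.ne hi)).1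
        fun c => (h c).2 a b hab i hi
    exact ⟨⟨fun a b hab i j hi hj => (hint a b hab i j hi hj).1, fun a b hab i hi =>
      (hbd a b hab i hi).1⟩, fun a b hab i j hi hj => (hint a b hab i j hi hj).2,
      fun a b hab i hi => (hbd a b hab i hi).2⟩
  · rintro ⟨htan, hnor⟩ c
    exact ⟨fun a b hab i j hi hj => (Poly2.edgeMean_curl_eq_iff hi.ne).2
      ⟨htan.1 a b hab i j hi hj, hnor.1 a b hab i j hi hj⟩ c,
      fun a b hab i hi => (Poly2.edgeMean_curl_eq_zero_iff hi.ne).2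
      ⟨htan.2 a b hab i hi, hnor.2 a b hab i hi⟩ c⟩

end Edges

section Boundary

variable {i j : ι} {k : Fin 4} {y : Plane}

theorem isEdge_of_mem_openSegment (hij : i ≠ j)
    (hy : y ∈ openSegment ℝ ((G.cell i).vertex k) ((G.cell i).vertex (k + 1)))
    (hyj : y ∈ (G.cell j).carrier) :
    (G.cell j).IsEdge ((G.cell i).vertex k) ((G.cell i).vertex (k + 1)) ∧
      (G.cell i).carrier ∩ (G.cell j).carrier =
        segment ℝ ((G.cell i).vertex k) ((G.cell i).vertex (k + 1)) := by
  have hyi := (G.cell i).segment_subset_carrier k (openSegment_subset_segment ℝ _ _ hy)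
  obtain h | ⟨a, ⟨m, rfl⟩, -, h⟩ | ⟨a, b, ⟨m, hm⟩, hedge, h⟩ := G.conforming i j hij
  · exact absurd (h.subset ⟨hyi, hyj⟩) (notMem_empty y)
  · obtain rfl := h.subset ⟨hyi, hyj⟩
    exact absurd hy ((G.cell i).vertex_notMem_openSegment m k)
  · have hseg := h.subset ⟨hyi, hyj⟩
    obtain ⟨rfl, rfl⟩ | ⟨rfl, rfl⟩ := hm
    · obtain rfl := (G.cell i).eq_of_mem_openSegment_of_mem_segment hy hseg
      exact ⟨hedge, h⟩
    · rw [segment_symm] at hseg h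
      obtain rfl := (G.cell i).eq_of_mem_openSegment_of_mem_segment hy hseg
      exact ⟨hedge.symm, h⟩

theorem mem_interior_closure_iff [Finite ι]
    (hy : y ∈ openSegment ℝ ((G.cell i).vertex k) ((G.cell i).vertex (k + 1))) :
    y ∈ interior (closure Ω) ↔ ∃ j, i ≠ j ∧ y ∈ (G.cell j).carrier := by
  constructor
  · intro hint
    by_contra! hother
    obtain ⟨z, hzi, hzΩ, hsub⟩ := ((ConvexQuad.frequently_notMem_carrier hy).and_eventually
      ((isOpen_interior.eventually_mem hint).and
        ((locallyFinite_of_finite fun j => (G.cell j).carrier).eventually_subset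
          (fun j => (G.cell j).isClosed_carrier) y))).exists
    obtain ⟨j, hj⟩ := G.exists_mem_carrier (interior_subset hzΩ)
    exact hother j (fun hij => hzi (hij ▸ hj)) (hsub hj)
  · rintro ⟨j, hij, hyj⟩
    obtain ⟨hedge, hinter⟩ := G.isEdge_of_mem_openSegment hij hy hyj
    rw [mem_interior_iff_mem_nhds]
    filter_upwards [ConvexQuad.union_carrier_mem_nhds ⟨k, Or.inl ⟨rfl, rfl⟩⟩ hedge hinter hy] with
      z hz
    exact hz.elim (fun h => G.carrier_subset_closure i h) fun h => G.carrier_subset_closure j h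

theorem segment_subset_frontier [Finite ι]
    (hy : y ∈ openSegment ℝ ((G.cell i).vertex k) ((G.cell i).vertex (k + 1)))
    (hint : y ∉ interior (closure Ω)) :
    segment ℝ ((G.cell i).vertex k) ((G.cell i).vertex (k + 1)) ⊆ frontier Ω := by
  rw [← closure_openSegment]
  refine closure_minimal (fun z hz => frontier_closure_subset ?_) isClosed_frontier
  have hz_carrier := (G.cell i).segment_subset_carrier k (openSegment_subset_segment ℝ _ _ hz)
  refine ⟨subset_closure (G.carrier_subset_closure i hz_carrier), fun hz_int => hint ?_⟩
  obtain ⟨j, hij, hzj⟩ := (G.mem_interior_closure_iff hz).1 hz_int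
  have hinter := (G.isEdge_of_mem_openSegment hij hz hzj).2
  exact (G.mem_interior_closure_iff hy).2
    ⟨j, hij, (hinter.superset (openSegment_subset_segment ℝ _ _ hy)).2⟩

theorem isVertex_or_exists_segment_subset_frontier [Finite ι] (hy : y ∈ (G.cell i).carrier)
    (hint : y ∉ interior (closure Ω)) :
    (G.cell i).IsVertex y ∨ ∃ k, y ∈ segment ℝ ((G.cell i).vertex k) ((G.cell i).vertex (k + 1)) ∧
      segment ℝ ((G.cell i).vertex k) ((G.cell i).vertex (k + 1)) ⊆ frontier Ω := by
  refine ((G.cell i).isVertex_or_mem_openSegment_of_notMem_interior hy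
    fun h => hint (interior_mono (G.carrier_subset_closure i) h)).imp_right ?_
  rintro ⟨k, hk⟩
  exact ⟨k, openSegment_subset_segment ℝ _ _ hk, G.segment_subset_frontier hk hint⟩

end Boundary

section Gluing

variable {G} {q g : ι → Plane → ℝ}

theorem EdgeConforming.interpolant_sub_eq (hq : G.EdgeConforming fun i a b => q i b - q i a)
    (hg : ∀ i, (G.cell i).InterpolatesEdges (q i) (g i)) {i j : ι} {y z : Plane}
    (hy : y ∈ (G.cell i).carrier ∩ (G.cell j).carrier)
    (hz : z ∈ (G.cell i).carrier ∩ (G.cell j).carrier) : g i y - g j y = g i z - g j z := by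
  obtain rfl | hij := eq_or_ne i j
  · rw [sub_self, sub_self]
  obtain h | ⟨a, -, -, h⟩ | ⟨a, b, hi, hj, h⟩ := G.conforming i j hij <;> rw [h] at hy hz
  · exact absurd hy (notMem_empty y)
  · rw [mem_singleton_iff.1 hy, mem_singleton_iff.1 hz]
  · have hconst : ∀ x ∈ segment ℝ a b, g i x - g j x = q i a - q j a := fun x =>
      (hg i).sub_eq_of_mem_segment (hg j) hi hj (hq.eq hi hj)
    rw [hconst y hy, hconst z hz]

theorem EdgeConforming.eventually_interpolant_eq [Finite ι] (hΩ : interior (closure Ω) = Ω)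
    (hq : G.EdgeConforming fun i a b => q i b - q i a) {i : ι}
    (hg : (G.cell i).InterpolatesEdges (q i) (g i)) (x : Plane) :
    ∀ᶠ z in 𝓝[(G.cell i).carrier ∩ Ωᶜ] x, g i z = g i x := by
  classical
  let Q := G.cell i
  let S : Fin 4 → Set Plane := fun k =>
    if segment ℝ (Q.vertex k) (Q.vertex (k + 1)) ⊆ frontier Ω then
      segment ℝ (Q.vertex k) (Q.vertex (k + 1))
    else {Q.vertex k}
  refine eventually_eq_of_finite_closed_cover (S := S) (fun k => ?_) (fun z hz => ?_)
    (fun k y hy z hz => ?_) x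
  · dsimp only [S]
    split_ifs
    · rw [segment_eq_image_lineMap]
      exact (isCompact_Icc.image AffineMap.lineMap_continuous).isClosed
    · exact isClosed_singleton
  · obtain ⟨k, rfl⟩ | ⟨k, hk, hsub⟩ :=
      G.isVertex_or_exists_segment_subset_frontier hz.1 (by rw [hΩ]; exact hz.2)
    · refine mem_iUnion.2 ⟨k, ?_⟩
      dsimp only [S]
      split_ifs
      exacts [left_mem_segment ℝ _ _, mem_singleton _]
    · exact mem_iUnion.2 ⟨k, by rwa [show S k = _ from if_pos hsub]⟩
  · dsimp only [S] at hy hz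
    split_ifs at hy hz with hsub
    · have hedge : Q.IsEdge (Q.vertex k) (Q.vertex (k + 1)) := ⟨k, Or.inl ⟨rfl, rfl⟩⟩
      have hzero := hq.2 _ _ ⟨⟨i, hedge⟩, hsub⟩ i hedge
      rw [hg.eq_of_mem_segment hedge hzero hy, hg.eq_of_mem_segment hedge hzero hz]
    · rw [mem_singleton_iff.1 hy, mem_singleton_iff.1 hz]

theorem EdgeConforming.exists_interpolant_add_eq [Finite ι] (hΩ : interior (closure Ω) = Ω)
    (hc : IsPreconnected Ωᶜ) (hq : G.EdgeConforming fun i a b => q i b - q i a)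
    (hg : ∀ i, (G.cell i).InterpolatesEdges (q i) (g i)) :
    ∃ C : ι → ℝ,
      (∀ i j, ∀ x ∈ (G.cell i).carrier ∩ (G.cell j).carrier, g i x + C i = g j x + C j) ∧
      ∀ i, ∀ x ∈ (G.cell i).carrier ∩ Ωᶜ, g i x + C i = 0 := by
  -- The complement of `Ω` joins the cells as a further piece, carrying the function `0`.
  let K : Option ι → Set Plane := fun o => o.elim Ωᶜ fun i => (G.cell i).carrier
  let f : Option ι → Plane → ℝ := fun o => o.elim 0 g
  have hclosed : ∀ o, IsClosed (K o) := Option.forall.2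
    ⟨(hΩ ▸ isOpen_interior : IsOpen Ω).isClosed_compl, fun i => (G.cell i).isClosed_carrier⟩
  have hpre : ∀ o, IsPreconnected (K o) :=
    Option.forall.2 ⟨hc, fun i => (G.cell i).convex_carrier.isPreconnected⟩
  have hcov : ⋃ o, K o = univ := by
    rw [iUnion_option, eq_univ_iff_forall]
    refine fun z => (em (z ∈ Ω)).symm.imp_right fun hz => ?_
    exact mem_iUnion.2 (G.exists_mem_carrier (subset_closure hz))
  obtain ⟨C, hC⟩ := exists_add_const_eq_of_closed_cover hclosed hpre (locallyFinite_of_finite K)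
    hcov f <| by
      rintro (_ | i) (_ | j) x hx
      · simp [f]
      · filter_upwards [inter_comm _ _ ▸ hq.eventually_interpolant_eq hΩ (hg j) x] with z hz
        simp [f, hz]
      · filter_upwards [hq.eventually_interpolant_eq hΩ (hg i) x] with z hz
        simp [f, hz]
      · filter_upwards [self_mem_nhdsWithin] with z hz
        exact hq.interpolant_sub_eq hg hz hx
  refine ⟨fun i => C (some i) - C none, fun i j x hx => ?_, fun i x hx => ?_⟩
  · rw [← add_sub_assoc, ← add_sub_assoc, show g i x + C (some i) = g j x + C (some j) from
      hC (some i) (some j) x hx]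
  · rw [← add_sub_assoc, show g i x + C (some i) = 0 + C none from hC (some i) none x hx, zero_add,
      sub_self]

theorem EdgeConforming.exists_vertexConforming [Finite ι] (hΩ : interior (closure Ω) = Ω)
    (hc : IsPreconnected Ωᶜ) (hq : G.EdgeConforming fun i a b => q i b - q i a) :
    ∃ C : ι → ℝ, G.VertexConforming fun i a => q i a + C i := by
  choose g hg using fun i => (G.cell i).exists_interpolatesEdges (q i)
  obtain ⟨C, hcells, hcompl⟩ := hq.exists_interpolant_add_eq hΩ hc hg
  have hopen : IsOpen Ω := hΩ ▸ isOpen_interior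
  refine ⟨C, fun a i j hi hj => ?_, fun a ha i hi => ?_⟩ <;>
    simp only [← (hg _).apply_vertex hi]
  · rw [← (hg j).apply_vertex hj]
    exact hcells i j a ⟨hi.mem_carrier, hj.mem_carrier⟩
  · exact hcompl i a ⟨hi.mem_carrier, (hopen.frontier_eq ▸ ha).2⟩

end Gluing

end QuadMesh

theorem mainTheorem4_general {ι : Type*} [Finite ι] {Ω : Set Plane} (hΩ : interior (closure Ω) = Ω)
    (hc : IsPreconnected Ωᶜ) (G : QuadMesh Ω ι) : G.curlImage G.RQM0 = G.divFreePS0 := by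
  have hopen : IsOpen Ω := hΩ ▸ isOpen_interior
  ext w
  rw [QuadMesh.mem_curlImage_RQM0_iff hopen, QuadMesh.mem_divFreePS0_iff hopen]
  constructor
  · rintro ⟨p, hp, hdeg, hvert, hnor⟩
    refine ⟨fun i => (p i).curl, hp, fun i => (p i).div_curl, fun i c => ?_, ?_⟩
    · exact ((p i).totalDegree_curl_le c).trans (Nat.sub_le_sub_right (hdeg i) 1)
    · exact QuadMesh.edgeConforming_edgeMean_curl_iff.2 ⟨hvert.edgeConforming_sub, hnor⟩
  · rintro ⟨p, hp, hdiv, hdeg, hedge⟩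
    choose q hqdeg hq using fun i => Poly2.exists_curl_eq_of_div_eq_zero (hdeg i) (hdiv i)
    obtain rfl : (fun i => (q i).curl) = p := funext hq
    have htan := (QuadMesh.edgeConforming_edgeMean_curl_iff.1 hedge).1
    obtain ⟨C, hC⟩ := htan.exists_vertexConforming hΩ hc
    have hcurl : ∀ i, (q i + MvPolynomial.C (C i)).curl = (q i).curl := fun i =>
      (q i).curl_add_C (C i)
    refine ⟨fun i => q i + MvPolynomial.C (C i), ?_, fun i => ?_, ?_, ?_⟩
    · simpa only [hcurl] using hp
    · refine (MvPolynomial.totalDegree_add _ _).trans (max_le (hqdeg i) ?_)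
      exact MvPolynomial.totalDegree_C (C i) ▸ Nat.zero_le _
    · simpa only [QuadMesh.VertexConforming, Poly2.evalAt_add_C] using hC
    · refine (QuadMesh.edgeConforming_edgeMean_curl_iff.1 ?_).2
      simpa only [hcurl] using hedge

theorem mainTheorem4 {ι : Type*} [Finite ι] {Ω : Set Plane} (hΩ : IsLipschitzDomain Ω)
    (hsc : IsSimplyConnected Ω) (G : QuadMesh Ω ι) :
    G.curlImage G.RQM0 = G.divFreePS0 :=
  mainTheorem4_general hΩ.interior_closure_eq
    (isPreconnected_compl_of_isSimplyConnected hsc hΩ.isOpen hΩ.isBounded) G
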